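/- **Setting.** Let $\mathcal D\subseteq\mathcal D_\infty(R):=\{x\in\mathbb R^d:\|x\|_\infty\le R\}$ be convex, $R>0$. In round $t=1,\dots,n$ nature reveals $A_t\in\mathbb R^{p\times d}$ with rows $a_{t,1},\dots,a_{t,p}$, the learner plays $\hat w_t\in\mathcal D$, and then $b_t\in\mathbb R^p$ is revealed, with loss $f_t(z)=\|A_tz-b_t\|_2^2$. Assume $\|a_{t,i}\|_1\le\alpha$ for all $t,i$, with $\alpha>0$. Let $G>0$ and $L$ satisfy, for all $t\in[n]$, $$\sup_{w_1,w_2\in\mathcal D_\infty(R)}\|A_t(w_1+w_2)-2b_t\|_1\le G,\qquad \sup_{w\in\mathcal D_\infty(R)}2\|A_tw-b_t\|_2^2+2G^2\le L,$$ and put $\kappa=\frac1{4L}$, $\gamma=2G\alpha R\sqrt{d/(8L)}+\sqrt{2L}$, $\zeta=\min\{\frac1{16G\alpha R\sqrt d},\frac1{4\gamma^2}\}$, $\eta=\frac1{2\gamma^2}$. **ProDR.control** takes $w_t\in\mathcal D_\infty(R)$ from the algorithm FLH-ONS below, plays $\hat w_t\in\arg\min_{x\in\mathcal D}\max_i|a_{t,i}^\top(x-w_t)|$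 (assumed to be attained, as it is when $\mathcal D$ is nonempty and closed), and sends to FLH-ONS the loss $\ell_t(w)=f_t(w)+G\,S_t(w)$, where $S_t(w)=\inf_{x\in\mathcal D}\max_i|a_{t,i}^\top(x-w)|$. **FLH-ONS.** With $g_t$ a subgradient of $\ell_t$ at $w_t$, let $h_t(x)=\big(\sqrt{\kappa/2}\,g_t^\top(x-w_t)+1/\sqrt{2\kappa}\big)^2$. Base learner $j\in[n]$ starts in round $j$ with $y^{(j)}_j=0$ and is updated for $j\le t<n$ by $$y^{(j)}_{t+1}\in\arg\min_{x\in\mathcal D_\infty(R)}\Big\|y^{(j)}_t-\tfrac1\zeta (M^{(j)}_t)^{-1}\nabla h_t(y^{(j)}_t)-x\Big\|_{M^{(j)}_t},\qquad M^{(j)}_t=\zeta I+\sum_{i=j}^t\nabla h_i(y_i^{(j)})\nabla h_i(y_i^{(j)})^\top .$$ FLH plays $w_t=\sum_{j=1}^tv_t^{(j)}y_t^{(j)}$, where $v_1^{(1)}=1$, $v_{t+1}^{(t+1)}=\frac1{t+1}$, and $v_{t+1}^{(i)}=\big(1-\frac1{t+1}\big)\frac{v_t^{(i)}e^{-\eta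 h_t(y_t^{(i)})}}{\sum_{j\le t}v_t^{(j)}e^{-\eta h_t(y_t^{(j)})}}$ for $i\le t$. **Theorem.** (i) If $\|a_{t,i}\|_1\le\alpha$ and $\|b_t\|_1\le\sigma$ for all $t\in[n]$, $i\in[p]$, then $G=2p\alpha R+2\sigma$ and $L=10(p\alpha R+\sigma)^2$ satisfy the two displayed bounds on $G$ and $L$. (ii) There is an absolute integer $K\ge 0$, and for all $\alpha,R,G>0$ and $L$ a constant $C$ depending only on $(\alpha,R,G,L)$, such that for all $p,d,n$, all $\mathcal D$ and all data as above, every run of ProDR.control and every comparator sequence $u_1,\dots,u_n\in\mathcal D$ satisfy $$\sum_{t=1}^n\big(f_t(\hat w_t)-f_t(u_t)\big)\le C\,(1+\log n)^K\,d^3\Big(n^{1/3}\,[\mathcal{TV}(u_{1:n})]^{2/3}\vee1\Big),\qquad \mathcal{TV}(u_{1:n})=\sum_{t=2}^n\|u_t-u_{t-1}\|_1 .$$ That is, the dynamic regret is $\tilde O\big(d^3(n^{1/3}[\mathcal{TV}(u_{1:n})]^{2/3}\vee1)\big)$. -/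

import Mathlib

open scoped Matrix

noncomputable section

namespace ProDR

/-- The `ℓ₁` norm of a finite real vector. -/
def l1Norm {m : ℕ} (x : Fin m → ℝ) : ℝ := ∑ k, |x k|

/-- The box `{x : ‖x‖_∞ ≤ R}` in `ℝᵈ`. -/
def box (d : ℕ) (R : ℝ) : Set (Fin d → ℝ) := {x | ∀ k, |x k| ≤ R}

/-- The mini-batch regression loss `‖A z - b‖₂²`. -/
def regLoss {p d : ℕ} (A : Matrix (Fin p) (Fin d) ℝ) (b : Fin p → ℝ) (z : Fin d → ℝ) : ℝ :=
  ∑ i, ((A *ᵥ z) i - b i) ^ 2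

/-- `max_i |a_iᵀ (x - w)|`, where `a_i` is the `i`-th row of `A`. -/
def rowGap {p d : ℕ} (A : Matrix (Fin p) (Fin d) ℝ) (x w : Fin d → ℝ) : ℝ :=
  ⨆ i, |(A *ᵥ (x - w)) i|

/-- The barrier `S(w) = min_{x ∈ D} max_i |a_iᵀ (x - w)|`. -/
def barrier {p d : ℕ} (A : Matrix (Fin p) (Fin d) ℝ) (D : Set (Fin d → ℝ))
    (w : Fin d → ℝ) : ℝ :=
  sInf ((fun x => rowGap A x w) '' D)

/-- The loss `ℓ(w) = ‖A w - b‖₂² + G · S(w)` that is sent to the base algorithm. -/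
def barrierLoss {p d : ℕ} (A : Matrix (Fin p) (Fin d) ℝ) (b : Fin p → ℝ)
    (D : Set (Fin d → ℝ)) (G : ℝ) (w : Fin d → ℝ) : ℝ :=
  regLoss A b w + G * barrier A D w

/-- `x` belongs to `argmin_{y ∈ D} F y`. -/
def IsArgmin {d : ℕ} (F : (Fin d → ℝ) → ℝ) (D : Set (Fin d → ℝ)) (x : Fin d → ℝ) : Prop :=
  x ∈ D ∧ ∀ y ∈ D, F x ≤ F y

/-- `g` is a subgradient at `x` of `F : ℝᵈ → ℝ`
(the gradient, when `F` is convex and differentiable). -/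
def IsSubgradient {d : ℕ} (F : (Fin d → ℝ) → ℝ) (x g : Fin d → ℝ) : Prop :=
  ∀ y, F x + g ⬝ᵥ (y - x) ≤ F y

/-! ### Online Newton step -/

/-- `‖x‖_M = √(xᵀ M x)`. -/
def matNorm {d : ℕ} (M : Matrix (Fin d) (Fin d) ℝ) (x : Fin d → ℝ) : ℝ :=
  √(x ⬝ᵥ (M *ᵥ x))

/-- `ε I + ∑_{i=s}^{t} g_i g_iᵀ`. -/
def onsMatrix {d : ℕ} (ε : ℝ) (g : ℕ → Fin d → ℝ) (s t : ℕ) : Matrix (Fin d) (Fin d) ℝ :=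
  ε • (1 : Matrix (Fin d) (Fin d) ℝ) + ∑ i ∈ Finset.Icc s t, Matrix.vecMulVec (g i) (g i)

/-- `y s, …, y n` are the predictions of an online Newton step learner that is started in round
`s`, with decision set `K`, step size `1 / β` and regularization `ε I`, on the losses `h t`;
`g t` is the gradient of `h t` at its own prediction `y t`. -/
structure IsONS {d : ℕ} (K : Set (Fin d → ℝ)) (β ε : ℝ) (n s : ℕ)
    (h : ℕ → (Fin d → ℝ) → ℝ) (y g : ℕ → Fin d → ℝ) : Prop where
  init : y s = 0
  grad : ∀ t, s ≤ t → t ≤ n → IsSubgradient (h t) (y t) (g t)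
  step : ∀ t, s ≤ t → t < n →
    IsArgmin (fun x => matNorm (onsMatrix ε g s t)
      (y t - (1 / β) • ((onsMatrix ε g s t)⁻¹ *ᵥ g t) - x)) K (y (t + 1))

/-! ### Follow the leading history -/

/-- `x 1, …, x n` are the plays of follow-the-leading-history with learning rate `η` on the losses
`h t`; `E j t` is the prediction in round `t` of the base learner `j ≤ t`, and `v t j` is its
weight. -/
structure IsFLH {d : ℕ} (η : ℝ) (n : ℕ) (h : ℕ → (Fin d → ℝ) → ℝ)
    (E : ℕ → ℕ → Fin d → ℝ) (v : ℕ → ℕ → ℝ) (x : ℕ → Fin d → ℝ) : Prop where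
  init : v 1 1 = 1
  play : ∀ t, 1 ≤ t → t ≤ n → x t = ∑ j ∈ Finset.Icc 1 t, v t j • E j t
  add_new : ∀ t, 1 ≤ t → t < n → v (t + 1) (t + 1) = 1 / ((t : ℝ) + 1)
  update : ∀ t, 1 ≤ t → t < n → ∀ i, 1 ≤ i → i ≤ t →
    v (t + 1) i = (1 - 1 / ((t : ℝ) + 1)) *
      (v t i * Real.exp (-η * h t (E i t)) /
        ∑ j ∈ Finset.Icc 1 t, v t j * Real.exp (-η * h t (E j t)))

/-! ### FLH-ONS for exp-concave losses -/

/-- `(√(κ/2) gᵀ(y - x) + 1/√(2κ))²`, the quadratic surrogate of a `κ`-exp-concave loss with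
subgradient `g` at the played point `x`. -/
def quadSurrogate {d : ℕ} (κ : ℝ) (x g y : Fin d → ℝ) : ℝ :=
  (√(κ / 2) * (g ⬝ᵥ (y - x)) + 1 / √(2 * κ)) ^ 2

/-- `x 1, …, x n` are the plays of FLH-ONS against the losses `l 1, …, l n` on the decision set
`K`: FLH with learning rate `η`, run on the quadratic surrogates of the `l t` at the plays `x t`
(exp-concavity parameter `κ`); its base learner `j` is ONS with parameter `ζ`, started in
round `j`. -/
def IsFLHONS {d : ℕ} (K : Set (Fin d → ℝ)) (κ ζ η : ℝ) (n : ℕ)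
    (l : ℕ → (Fin d → ℝ) → ℝ) (x : ℕ → Fin d → ℝ) : Prop :=
  ∃ (g : ℕ → Fin d → ℝ) (E gE : ℕ → ℕ → Fin d → ℝ) (v : ℕ → ℕ → ℝ),
    (∀ t, 1 ≤ t → t ≤ n → IsSubgradient (l t) (x t) (g t)) ∧
    (∀ j, 1 ≤ j → j ≤ n →
      IsONS K ζ ζ n j (fun t => quadSurrogate κ (x t) (g t)) (E j) (gE j)) ∧
    IsFLH η n (fun t => quadSurrogate κ (x t) (g t)) E v x

/-! ### ProDR.control -/

/-- `γ = 2 G α R √(d / (8 L)) + √(2 L)`. -/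
def gammaParam (d : ℕ) (α R G L : ℝ) : ℝ :=
  2 * G * α * R * √((d : ℝ) / (8 * L)) + √(2 * L)

/-- `ζ = min {1 / (16 G α R √d), 1 / (4 γ²)}`. -/
def zetaParam (d : ℕ) (α R G L : ℝ) : ℝ :=
  min (1 / (16 * G * α * R * √(d : ℝ))) (1 / (4 * gammaParam d α R G L ^ 2))

/-- `z 1, …, z n` are the plays of ProDR.control with decision set `D` on the data `A t, b t`,
where `w t` are the plays of FLH-ONS on the box of radius `R`, run with the parameters
`κ = 1/(4L)`, `ζ` and `η = 1/(2γ²)`. -/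
def IsProDR {p d : ℕ} (D : Set (Fin d → ℝ)) (α R G L : ℝ) (n : ℕ)
    (A : ℕ → Matrix (Fin p) (Fin d) ℝ) (b : ℕ → Fin p → ℝ) (w z : ℕ → Fin d → ℝ) : Prop :=
  IsFLHONS (box d R) (1 / (4 * L)) (zetaParam d α R G L)
      (1 / (2 * gammaParam d α R G L ^ 2)) n (fun t => barrierLoss (A t) (b t) D G) w ∧
    ∀ t, 1 ≤ t → t ≤ n → IsArgmin (fun x => rowGap (A t) x (w t)) D (z t)

/-- The rows of `A 1, …, A n` have `ℓ₁` norm at most `α`. -/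
def RowsBounded {p d : ℕ} (α : ℝ) (n : ℕ) (A : ℕ → Matrix (Fin p) (Fin d) ℝ) : Prop :=
  ∀ t, 1 ≤ t → t ≤ n → ∀ i, l1Norm (A t i) ≤ α

/-- `‖A_t (w₁ + w₂) - 2 b_t‖₁ ≤ G` for all `w₁, w₂` in the box of radius `R` and `t ∈ [n]`. -/
def ValidG {p d : ℕ} (R G : ℝ) (n : ℕ)
    (A : ℕ → Matrix (Fin p) (Fin d) ℝ) (b : ℕ → Fin p → ℝ) : Prop :=
  ∀ t, 1 ≤ t → t ≤ n → ∀ w₁ ∈ box d R, ∀ w₂ ∈ box d R,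
    l1Norm (A t *ᵥ (w₁ + w₂) - (2 : ℝ) • b t) ≤ G

/-- `2 ‖A_t w - b_t‖₂² + 2 G² ≤ L` for all `w` in the box of radius `R` and `t ∈ [n]`. -/
def ValidL {p d : ℕ} (R G L : ℝ) (n : ℕ)
    (A : ℕ → Matrix (Fin p) (Fin d) ℝ) (b : ℕ → Fin p → ℝ) : Prop :=
  ∀ t, 1 ≤ t → t ≤ n → ∀ w ∈ box d R, 2 * regLoss (A t) (b t) w + 2 * G ^ 2 ≤ L

/-- The path variation `∑_{t=2}^n ‖u_t - u_{t-1}‖₁`. -/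
def pathVariation {d : ℕ} (n : ℕ) (u : ℕ → Fin d → ℝ) : ℝ :=
  ∑ t ∈ Finset.Icc 2 n, l1Norm (u t - u (t - 1))

/-- The dynamic regret `∑_{t=1}^n (f_t(z_t) - f_t(u_t))`, with `f_t(z) = ‖A_t z - b_t‖₂²`. -/
def dynamicRegret {p d : ℕ} (n : ℕ) (A : ℕ → Matrix (Fin p) (Fin d) ℝ) (b : ℕ → Fin p → ℝ)
    (z u : ℕ → Fin d → ℝ) : ℝ :=
  ∑ t ∈ Finset.Icc 1 n, (regLoss (A t) (b t) (z t) - regLoss (A t) (b t) (u t))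

end ProDR

end

/-!
Write `s = g_t · (x - w_t)`. The barrier loss `ℓ_t` is strongly convex in the seminorm `‖A_t x‖₂`
(`IsSubgradient.add_sum_sq_le`), and its subgradient in direction `v` is at most `√(4L) ‖A_t v‖₂`
(`IsSubgradient.sq_dotProduct_le`). Hence `ℓ_t(w_t) - ℓ_t(u) ≤ h_t(w_t) - h_t(u)`, where the
surrogate is `h_t = 1/(2κ) + s + κ s²/2`. The barrier pays for projecting onto `D`
(`regLoss_le_barrierLoss`) and vanishes on `D`, so the dynamic regret of `ProDR.control` is at most
that of FLH-ONS on the surrogates.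

On every interval and against every fixed point of the box, FLH-ONS has regret
`O(d³ (1 + log n))` (`flhons_interval_regret_le`): FLH loses `log n / η` to the base learner that
starts with the interval (`IsFLH.regret_le`), and this base learner is an online Newton step with
the usual log-determinant bound (`IsONS.regret_le_sum`, `sum_quadForm_inv_le`). In small dimension
the surrogates are not `η`-exp-concave on the whole box for `η = 1/(2γ²)`. FLH only needs the
mixability inequality at the played point, which is the mean of the base predictions and the point
about which the surrogate is built, and this does hold (`quadSurrogate_mix`).

The passage to moving comparators is a randomized rounding. Every coordinate of `u_t` is rounded to
a grid of width `δ` with one random threshold common to all coordinates and rounds. This is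
unbiased, so, the surrogates being quadratic, the rounding costs only `O(δ²)` per round in
expectation; and the rounded sequence is expected to change at most `TV/δ` times, so that it
consists of at most `1 + TV/δ` intervals on which the fixed-point regret bound applies. The choice
`δ ≈ (TV/n)^{1/3}` gives the rate `n^{1/3} TV^{2/3}`
(`sum_le_of_interval_le_of_grid`, `sum_le_of_interval_le_of_pathVariation`).
-/

noncomputable section

namespace ProDR

/-! ### Online Newton step -/

/-- A linear term that is dominated by a quadratic one near the origin is nonpositive. -/
theorem nonpos_of_mul_le_sq_mul {a b : ℝ} (h : ∀ ε : ℝ, 0 < ε → ε ≤ 1 → ε * a ≤ ε ^ 2 * b) :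
    a ≤ 0 := by
  by_contra! ha
  have hb : 0 < |b| + a := by positivity
  have h1 := h (a / (2 * (|b| + a))) (by positivity) (by
    rw [div_le_one (by positivity)]; nlinarith [abs_nonneg b])
  have hε : 0 < a / (2 * (|b| + a)) := by positivity
  have h2 : a ≤ a / (2 * (|b| + a)) * b := by
    refine le_of_mul_le_mul_left ?_ hε
    calc _ ≤ _ := h1
      _ = _ := by ring
  have h3 : a / (2 * (|b| + a)) * b ≤ a / 2 := by
    rw [div_mul_eq_mul_div, div_le_div_iff₀ (by positivity) (by norm_num)]
    nlinarith [le_abs_self b]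
  linarith

theorem dotProduct_mulVec_comm {d : ℕ} {M : Matrix (Fin d) (Fin d) ℝ} (hM : M.IsHermitian)
    (x y : Fin d → ℝ) : x ⬝ᵥ (M *ᵥ y) = y ⬝ᵥ (M *ᵥ x) := by
  have hT : Mᵀ = M := by simpa [Matrix.IsHermitian] using hM
  rw [Matrix.dotProduct_mulVec, ← Matrix.mulVec_transpose, hT, dotProduct_comm]

theorem quadForm_add {d : ℕ} {M : Matrix (Fin d) (Fin d) ℝ} (hM : M.IsHermitian)
    (x y : Fin d → ℝ) : (x + y) ⬝ᵥ (M *ᵥ (x + y)) =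
      x ⬝ᵥ (M *ᵥ x) + 2 * (x ⬝ᵥ (M *ᵥ y)) + y ⬝ᵥ (M *ᵥ y) := by
  rw [Matrix.mulVec_add, dotProduct_add, add_dotProduct, add_dotProduct,
    dotProduct_mulVec_comm hM y x]
  ring

theorem quadForm_smul {d : ℕ} (M : Matrix (Fin d) (Fin d) ℝ) (c : ℝ) (x : Fin d → ℝ) :
    (c • x) ⬝ᵥ (M *ᵥ (c • x)) = c ^ 2 * (x ⬝ᵥ (M *ᵥ x)) := by
  rw [Matrix.mulVec_smul, dotProduct_smul, smul_dotProduct, smul_eq_mul, smul_eq_mul]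
  ring

theorem quadForm_nonneg {d : ℕ} {M : Matrix (Fin d) (Fin d) ℝ} (hM : M.PosDef)
    (x : Fin d → ℝ) : 0 ≤ x ⬝ᵥ (M *ᵥ x) := by
  simpa using hM.posSemidef.dotProduct_mulVec_nonneg x

/-- The generalized Pythagorean inequality: projecting onto a convex set in the norm of `M` does
not increase the distance to the points of that set. -/
theorem quadForm_proj_le {d : ℕ} {M : Matrix (Fin d) (Fin d) ℝ} (hM : M.PosDef)
    {K : Set (Fin d → ℝ)} (hK : Convex ℝ K) {y z u : Fin d → ℝ}
    (hz : IsArgmin (fun x => matNorm M (y - x)) K z) (hu : u ∈ K) :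
    (z - u) ⬝ᵥ (M *ᵥ (z - u)) ≤ (y - u) ⬝ᵥ (M *ᵥ (y - u)) := by
  have hcross : (y - z) ⬝ᵥ (M *ᵥ (u - z)) * 2 ≤ 0 := by
    refine nonpos_of_mul_le_sq_mul (b := (u - z) ⬝ᵥ (M *ᵥ (u - z))) fun ε h0 h1 => ?_
    have hmem : z + ε • (u - z) ∈ K := hK.add_smul_sub_mem hz.1 hu ⟨h0.le, h1⟩
    have h2 : matNorm M (y - z) ≤ matNorm M (y - (z + ε • (u - z))) := hz.2 _ hmem
    rw [matNorm, matNorm, Real.sqrt_le_sqrt_iff (quadForm_nonneg hM _)] at h2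
    have h3 : y - (z + ε • (u - z)) = (y - z) + (-ε) • (u - z) := by module
    rw [h3, quadForm_add hM.1, quadForm_smul, Matrix.mulVec_smul, dotProduct_smul,
      smul_eq_mul] at h2
    nlinarith
  have h4 : z - u = (-1 : ℝ) • (u - z) := by module
  have h5 : y - u = (y - z) + (-1 : ℝ) • (u - z) := by module
  rw [h5, quadForm_add hM.1, h4, quadForm_smul, Matrix.mulVec_smul, dotProduct_smul, smul_eq_mul]
  have := quadForm_nonneg hM (y - z)
  linarith

/-- The matrix `ε I + ∑_{s ≤ i < T} g_i g_iᵀ` accumulated before round `T`; it is `onsMatrix` with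
a half-open range of rounds, so that `T = s` gives `ε I`. -/
def gramMatrix {d : ℕ} (ε : ℝ) (g : ℕ → Fin d → ℝ) (s T : ℕ) : Matrix (Fin d) (Fin d) ℝ :=
  ε • (1 : Matrix (Fin d) (Fin d) ℝ) + ∑ i ∈ Finset.Ico s T, Matrix.vecMulVec (g i) (g i)

theorem onsMatrix_eq_gramMatrix {d : ℕ} (ε : ℝ) (g : ℕ → Fin d → ℝ) (s t : ℕ) :
    onsMatrix ε g s t = gramMatrix ε g s (t + 1) := by
  rw [onsMatrix, gramMatrix, Finset.Ico_add_one_right_eq_Icc]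

theorem gramMatrix_self {d : ℕ} (ε : ℝ) (g : ℕ → Fin d → ℝ) (s : ℕ) :
    gramMatrix ε g s s = ε • (1 : Matrix (Fin d) (Fin d) ℝ) := by
  simp [gramMatrix]

theorem gramMatrix_succ {d : ℕ} (ε : ℝ) (g : ℕ → Fin d → ℝ) {s T : ℕ} (h : s ≤ T) :
    gramMatrix ε g s (T + 1) = gramMatrix ε g s T + Matrix.vecMulVec (g T) (g T) := by
  rw [gramMatrix, gramMatrix, Finset.sum_Ico_succ_top h, add_assoc]

theorem gramMatrix_posDef {d : ℕ} {ε : ℝ} (hε : 0 < ε) (g : ℕ → Fin d → ℝ) (s T : ℕ) :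
    (gramMatrix ε g s T).PosDef := by
  refine (Matrix.PosDef.one.smul hε).add_posSemidef (Matrix.posSemidef_sum _ fun i _ => ?_)
  simpa using Matrix.posSemidef_vecMulVec_self_star (g i)

theorem quadForm_gramMatrix_succ {d : ℕ} (ε : ℝ) (g : ℕ → Fin d → ℝ) {s T : ℕ} (h : s ≤ T)
    (x : Fin d → ℝ) : x ⬝ᵥ (gramMatrix ε g s (T + 1) *ᵥ x) =
      x ⬝ᵥ (gramMatrix ε g s T *ᵥ x) + (g T ⬝ᵥ x) ^ 2 := by
  rw [gramMatrix_succ ε g h, Matrix.add_mulVec, dotProduct_add, Matrix.vecMulVec_mulVec]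
  simp [dotProduct_smul, dotProduct_comm x (g T)]
  ring

/-- The effect of an unprojected Newton step on the distance to `u`. -/
theorem quadForm_newton_step {d : ℕ} {M : Matrix (Fin d) (Fin d) ℝ} (hM : M.PosDef) (c : ℝ)
    (y g u : Fin d → ℝ) :
    (y - c • (M⁻¹ *ᵥ g) - u) ⬝ᵥ (M *ᵥ (y - c • (M⁻¹ *ᵥ g) - u)) =
      (y - u) ⬝ᵥ (M *ᵥ (y - u)) - 2 * c * (g ⬝ᵥ (y - u)) + c ^ 2 * (g ⬝ᵥ (M⁻¹ *ᵥ g)) := by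
  have hdet : IsUnit M.det := (Matrix.isUnit_iff_isUnit_det M).1 hM.isUnit
  have h1 : y - c • (M⁻¹ *ᵥ g) - u = (y - u) + (-c) • (M⁻¹ *ᵥ g) := by module
  have h2 : M *ᵥ (M⁻¹ *ᵥ g) = g := by
    rw [Matrix.mulVec_mulVec, Matrix.mul_nonsing_inv _ hdet, Matrix.one_mulVec]
  rw [h1, quadForm_add hM.1, quadForm_smul, Matrix.mulVec_smul, h2, dotProduct_smul,
    dotProduct_comm (y - u) g, dotProduct_comm (M⁻¹ *ᵥ g) g, smul_eq_mul]
  ring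

/-- The regret of online Newton step, before the sum of the quadratic forms `gᵀ M⁻¹ g` is
bounded. -/
theorem IsONS.regret_le_sum {d : ℕ} {K : Set (Fin d → ℝ)} (hK : Convex ℝ K) {β ε : ℝ}
    (hβ : 0 < β) (hε : 0 < ε) {n s : ℕ} {h : ℕ → (Fin d → ℝ) → ℝ} {y g : ℕ → Fin d → ℝ}
    (H : IsONS K β ε n s h y g) {u : Fin d → ℝ} (hu : u ∈ K)
    (hcurv : ∀ t, s ≤ t → t ≤ n →
      h t (y t) + g t ⬝ᵥ (u - y t) + β / 2 * (g t ⬝ᵥ (u - y t)) ^ 2 ≤ h t u)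
    {T : ℕ} (hsT : s ≤ T) (hTn : T ≤ n) :
    ∑ t ∈ Finset.Ico s (T + 1), (h t (y t) - h t u) ≤
      1 / (2 * β) * ∑ t ∈ Finset.Ico s (T + 1), g t ⬝ᵥ ((gramMatrix ε g s (t + 1))⁻¹ *ᵥ g t) +
        β * ε / 2 * (u ⬝ᵥ u) := by
  -- One round: the curvature term pays for the growth of the matrix.
  have hround : ∀ t, s ≤ t → t ≤ n → h t (y t) - h t u +
      β / 2 * ((y t - (1 / β) • ((gramMatrix ε g s (t + 1))⁻¹ *ᵥ g t) - u) ⬝ᵥ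
        (gramMatrix ε g s (t + 1) *ᵥ
          (y t - (1 / β) • ((gramMatrix ε g s (t + 1))⁻¹ *ᵥ g t) - u))) ≤
      β / 2 * ((y t - u) ⬝ᵥ (gramMatrix ε g s t *ᵥ (y t - u))) +
        1 / (2 * β) * (g t ⬝ᵥ ((gramMatrix ε g s (t + 1))⁻¹ *ᵥ g t)) := by
    intro t hst htn
    have hc := hcurv t hst htn
    have hneg : g t ⬝ᵥ (u - y t) = -(g t ⬝ᵥ (y t - u)) := by
      rw [← neg_sub, dotProduct_neg]
    rw [hneg] at hc
    rw [quadForm_newton_step (gramMatrix_posDef hε g s (t + 1)),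
      quadForm_gramMatrix_succ ε g hst]
    set a := g t ⬝ᵥ (y t - u)
    set q := g t ⬝ᵥ ((gramMatrix ε g s (t + 1))⁻¹ *ᵥ g t)
    have e1 : β / 2 * (2 * (1 / β) * a) = a := by field_simp
    have e2 : β / 2 * ((1 / β) ^ 2 * q) = 1 / (2 * β) * q := by field_simp
    nlinarith
  have key : ∀ T, s ≤ T → T ≤ n →
      ∑ t ∈ Finset.Ico s T, (h t (y t) - h t u) +
        β / 2 * ((y T - u) ⬝ᵥ (gramMatrix ε g s T *ᵥ (y T - u))) ≤
      1 / (2 * β) * ∑ t ∈ Finset.Ico s T, g t ⬝ᵥ ((gramMatrix ε g s (t + 1))⁻¹ *ᵥ g t) +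
        β * ε / 2 * (u ⬝ᵥ u) := by
    intro T hsT
    induction T, hsT using Nat.le_induction with
    | base =>
      intro _
      simp [gramMatrix_self, H.init, Matrix.smul_mulVec, Matrix.mulVec_neg]
      apply le_of_eq
      ring
    | succ T hsT ih =>
      intro hTn
      have ih' := ih (by omega)
      have hr := hround T hsT (by omega)
      have hp := quadForm_proj_le (gramMatrix_posDef hε g s (T + 1)) hK
        (by simpa [onsMatrix_eq_gramMatrix] using H.step T hsT (by omega)) hu
      have hp' := mul_le_mul_of_nonneg_left hp (by positivity : 0 ≤ β / 2)
      rw [Finset.sum_Ico_succ_top hsT, Finset.sum_Ico_succ_top hsT, mul_add]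
      simp only [one_div] at *
      linarith
  have h1 := key T hsT hTn
  have h2 := hround T hsT hTn
  have h3 := mul_nonneg (by positivity : 0 ≤ β / 2)
    (quadForm_nonneg (gramMatrix_posDef hε g s (T + 1))
      (y T - (1 / β) • ((gramMatrix ε g s (T + 1))⁻¹ *ᵥ g T) - u))
  rw [Finset.sum_Ico_succ_top hsT, Finset.sum_Ico_succ_top hsT, mul_add]
  linarith

/-- The elliptical potential inequality for one round, from the matrix determinant lemma and
`log x ≤ x - 1`. -/
theorem quadForm_inv_le_log_det {d : ℕ} {ε : ℝ} (hε : 0 < ε) (g : ℕ → Fin d → ℝ) {s T : ℕ}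
    (h : s ≤ T) : g T ⬝ᵥ ((gramMatrix ε g s (T + 1))⁻¹ *ᵥ g T) ≤
      Real.log (gramMatrix ε g s (T + 1)).det - Real.log (gramMatrix ε g s T).det := by
  have hM := gramMatrix_posDef hε g s (T + 1)
  have hN := gramMatrix_posDef hε g s T
  have hdet : IsUnit (gramMatrix ε g s (T + 1)).det := (Matrix.isUnit_iff_isUnit_det _).1 hM.isUnit
  have h1 : gramMatrix ε g s T = gramMatrix ε g s (T + 1) +
      Matrix.replicateCol Unit (-g T) * Matrix.replicateRow Unit (g T) := by
    rw [← Matrix.vecMulVec_eq, gramMatrix_succ ε g h, Matrix.neg_vecMulVec]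
    abel
  have h2 : (gramMatrix ε g s T).det = (gramMatrix ε g s (T + 1)).det *
      (1 - g T ⬝ᵥ ((gramMatrix ε g s (T + 1))⁻¹ *ᵥ g T)) := by
    conv_lhs => rw [h1]
    rw [Matrix.det_add_replicateCol_mul_replicateRow hdet]
    congr 1
    rw [Matrix.det_unique, Matrix.add_apply, Matrix.one_apply_eq, Matrix.mul_assoc]
    rw [sub_eq_add_neg, ← dotProduct_neg, ← Matrix.mulVec_neg]
    rfl
  have hpos : 0 < 1 - g T ⬝ᵥ ((gramMatrix ε g s (T + 1))⁻¹ *ᵥ g T) := by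
    have := hN.det_pos
    rw [h2] at this
    exact (pos_iff_pos_of_mul_pos this).1 hM.det_pos
  rw [h2, Real.log_mul hM.det_pos.ne' hpos.ne']
  linarith [Real.log_le_sub_one_of_pos hpos]

theorem log_det_le_of_posDef {d : ℕ} {M : Matrix (Fin d) (Fin d) ℝ} (hM : M.PosDef) :
    Real.log M.det ≤ d * Real.log M.trace := by
  have hdet : M.det = ∏ i, hM.1.eigenvalues i := by
    simpa using hM.1.det_eq_prod_eigenvalues
  have htr : M.trace = ∑ i, hM.1.eigenvalues i := by
    simpa using hM.1.trace_eq_sum_eigenvalues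
  have hpos : ∀ i, 0 < hM.1.eigenvalues i := hM.eigenvalues_pos
  rw [hdet, Real.log_prod fun i _ => (hpos i).ne']
  calc ∑ i, Real.log (hM.1.eigenvalues i) ≤ ∑ _i : Fin d, Real.log M.trace := by
        refine Finset.sum_le_sum fun i _ => Real.log_le_log (hpos i) ?_
        rw [htr]
        exact Finset.single_le_sum (fun j _ => (hpos j).le) (Finset.mem_univ i)
    _ = d * Real.log M.trace := by simp

theorem trace_gramMatrix {d : ℕ} (ε : ℝ) (g : ℕ → Fin d → ℝ) (s T : ℕ) :
    (gramMatrix ε g s T).trace = d * ε + ∑ t ∈ Finset.Ico s T, g t ⬝ᵥ g t := by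
  simp [gramMatrix, Matrix.trace_add, Matrix.trace_smul, Matrix.trace_sum,
    Matrix.trace_vecMulVec]
  ring

/-- The elliptical potential lemma. -/
theorem sum_quadForm_inv_le {d : ℕ} (hd : 1 ≤ d) {ε : ℝ} (hε : 0 < ε) (g : ℕ → Fin d → ℝ)
    {s T : ℕ} (h : s ≤ T) :
    ∑ t ∈ Finset.Ico s T, g t ⬝ᵥ ((gramMatrix ε g s (t + 1))⁻¹ *ᵥ g t) ≤
      d * Real.log (d + (∑ t ∈ Finset.Ico s T, g t ⬝ᵥ g t) / ε) := by
  have key : ∑ t ∈ Finset.Ico s T, g t ⬝ᵥ ((gramMatrix ε g s (t + 1))⁻¹ *ᵥ g t) ≤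
      Real.log (gramMatrix ε g s T).det - Real.log (gramMatrix ε g s s).det := by
    induction T, h using Nat.le_induction with
    | base => simp
    | succ T hsT ih =>
      rw [Finset.sum_Ico_succ_top hsT]
      linarith [quadForm_inv_le_log_det hε g hsT]
  have h1 := log_det_le_of_posDef (gramMatrix_posDef hε g s T)
  have h2 : Real.log (gramMatrix ε g s s).det = d * Real.log ε := by
    rw [gramMatrix_self, Matrix.det_smul]
    simp
  have hnn : 0 ≤ ∑ t ∈ Finset.Ico s T, g t ⬝ᵥ g t :=
    Finset.sum_nonneg fun t _ => Finset.sum_nonneg fun k _ => mul_self_nonneg _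
  have hd' : (0 : ℝ) < d := by exact_mod_cast hd
  have h3 : Real.log (d + (∑ t ∈ Finset.Ico s T, g t ⬝ᵥ g t) / ε) =
      Real.log (gramMatrix ε g s T).trace - Real.log ε := by
    rw [trace_gramMatrix, ← Real.log_div (by positivity) hε.ne']
    congr 1
    field_simp
  rw [h3, mul_sub]
  linarith

/-! ### Follow the leading history -/

theorem IsFLH.weight_pos_and_sum {d : ℕ} {η : ℝ} {n : ℕ} {h : ℕ → (Fin d → ℝ) → ℝ}
    {E : ℕ → ℕ → Fin d → ℝ} {v : ℕ → ℕ → ℝ} {x : ℕ → Fin d → ℝ} (H : IsFLH η n h E v x)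
    {t : ℕ} (h1 : 1 ≤ t) (htn : t ≤ n) :
    (∀ j ∈ Finset.Icc 1 t, 0 < v t j) ∧ ∑ j ∈ Finset.Icc 1 t, v t j = 1 := by
  induction t, h1 using Nat.le_induction with
  | base =>
    have := H.init
    refine ⟨fun j hj => ?_, by simpa using this⟩
    obtain rfl : j = 1 := by simpa using hj
    rw [this]; exact one_pos
  | succ t h1 ih =>
    obtain ⟨hpos, hsum⟩ := ih (by omega)
    have ht : (0 : ℝ) < t := by exact_mod_cast h1
    have hfac : 1 - 1 / ((t : ℝ) + 1) = t / (t + 1) := by field_simp; ring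
    have hW : 0 < ∑ j ∈ Finset.Icc 1 t, v t j * Real.exp (-η * h t (E j t)) :=
      Finset.sum_pos (fun j hj => mul_pos (hpos j hj) (Real.exp_pos _)) ⟨1, by simp [h1]⟩
    have hup : ∀ i ∈ Finset.Icc 1 t, v (t + 1) i = t / ((t : ℝ) + 1) *
        (v t i * Real.exp (-η * h t (E i t)) /
          ∑ j ∈ Finset.Icc 1 t, v t j * Real.exp (-η * h t (E j t))) := by
      intro i hi
      rw [Finset.mem_Icc] at hi
      rw [H.update t h1 (by omega) i hi.1 hi.2, hfac]
    have hnew := H.add_new t h1 (by omega)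
    constructor
    · intro j hj
      rcases eq_or_ne j (t + 1) with rfl | hne
      · rw [hnew]; positivity
      · have hj' : j ∈ Finset.Icc 1 t := by
          rw [Finset.mem_Icc] at hj ⊢; omega
        rw [hup j hj']
        exact mul_pos (by positivity) (div_pos (mul_pos (hpos j hj') (Real.exp_pos _)) hW)
    · rw [Finset.sum_Icc_succ_top (by omega), Finset.sum_congr rfl hup, ← Finset.mul_sum,
        ← Finset.sum_div, div_self hW.ne', hnew]
      field_simp

/-- The regret of follow-the-leading-history against the base learner started in round `r`. The
weight of that learner, multiplied by the number of the round, grows at least like the exponential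
of the regret accumulated so far. -/
theorem IsFLH.regret_le {d : ℕ} {η : ℝ} (hη : 0 < η) {n : ℕ} {h : ℕ → (Fin d → ℝ) → ℝ}
    {E : ℕ → ℕ → Fin d → ℝ} {v : ℕ → ℕ → ℝ} {x : ℕ → Fin d → ℝ} (H : IsFLH η n h E v x)
    (hmix : ∀ t, 1 ≤ t → t ≤ n → ∑ j ∈ Finset.Icc 1 t, v t j * Real.exp (-η * h t (E j t)) ≤
      Real.exp (-η * h t (x t)))
    {r s : ℕ} (hr : 1 ≤ r) (hrs : r ≤ s) (hsn : s ≤ n) :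
    ∑ t ∈ Finset.Ico r (s + 1), (h t (x t) - h t (E r t)) ≤ Real.log s / η := by
  have hround : ∀ t, r ≤ t → t ≤ n → v t r * Real.exp (η * (h t (x t) - h t (E r t))) ≤
      v t r * Real.exp (-η * h t (E r t)) /
        ∑ j ∈ Finset.Icc 1 t, v t j * Real.exp (-η * h t (E j t)) := by
    intro t hrt htn
    have hpos := (H.weight_pos_and_sum (by omega) htn).1
    have hW : 0 < ∑ j ∈ Finset.Icc 1 t, v t j * Real.exp (-η * h t (E j t)) :=
      Finset.sum_pos (fun j hj => mul_pos (hpos j hj) (Real.exp_pos _)) ⟨1, by simp; omega⟩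
    have hv := hpos r (by simp; omega)
    rw [le_div_iff₀ hW]
    calc _ ≤ v t r * Real.exp (η * (h t (x t) - h t (E r t))) * Real.exp (-η * h t (x t)) :=
          mul_le_mul_of_nonneg_left (hmix t (by omega) htn) (by positivity)
      _ = _ := by
          rw [mul_assoc, ← Real.exp_add]
          congr 2
          ring
  have key : ∀ t, r ≤ t → t ≤ n →
      Real.exp (η * ∑ i ∈ Finset.Ico r t, (h i (x i) - h i (E r i))) ≤ t * v t r := by
    intro t hrt
    induction t, hrt using Nat.le_induction with
    | base =>
      intro hrn
      rcases eq_or_lt_of_le hr with rfl | hr'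
      · simp [H.init]
      · obtain ⟨q, rfl⟩ : ∃ q, r = q + 1 := ⟨r - 1, by omega⟩
        rw [H.add_new q (by omega) (by omega)]
        simp only [Finset.Ico_self, Finset.sum_empty, mul_zero, Real.exp_zero]
        push_cast
        rw [mul_one_div_cancel (by positivity)]
    | succ t hrt ih =>
      intro htn
      have ht : (0 : ℝ) < t := by exact_mod_cast (by omega : 0 < t)
      rw [Finset.sum_Ico_succ_top hrt, mul_add, Real.exp_add,
        H.update t (by omega) (by omega) r hr hrt]
      push_cast
      calc _ ≤ t * v t r * Real.exp (η * (h t (x t) - h t (E r t))) :=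
            mul_le_mul_of_nonneg_right (ih (by omega)) (Real.exp_pos _).le
        _ ≤ t * (v t r * Real.exp (-η * h t (E r t)) /
              ∑ j ∈ Finset.Icc 1 t, v t j * Real.exp (-η * h t (E j t))) := by
            rw [mul_assoc]
            exact mul_le_mul_of_nonneg_left (hround t hrt (by omega)) ht.le
        _ = _ := by
            have : 1 - 1 / ((t : ℝ) + 1) = t / (t + 1) := by field_simp; ring
            rw [this]
            field_simp
  have hs : (0 : ℝ) < s := by exact_mod_cast (by omega : 0 < s)
  have hpos := (H.weight_pos_and_sum (by omega) hsn).1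
  have hlast : v s r * Real.exp (η * (h s (x s) - h s (E r s))) ≤ 1 := by
    refine (hround s hrs hsn).trans (div_le_one_of_le₀ ?_ ?_)
    · exact Finset.single_le_sum (f := fun j => v s j * Real.exp (-η * h s (E j s)))
        (fun j hj => mul_nonneg (hpos j hj).le (Real.exp_pos _).le) (by simp; omega)
    · exact Finset.sum_nonneg fun j hj => mul_nonneg (hpos j hj).le (Real.exp_pos _).le
  rw [le_div_iff₀ hη, mul_comm, Finset.sum_Ico_succ_top hrs, mul_add,
    Real.le_log_iff_exp_le hs, Real.exp_add]
  calc _ ≤ s * v s r * Real.exp (η * (h s (x s) - h s (E r s))) :=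
        mul_le_mul_of_nonneg_right (key s hrs hsn) (Real.exp_pos _).le
    _ ≤ s := by
        rw [mul_assoc]
        exact mul_le_of_le_one_right hs.le hlast

/-! ### The quadratic surrogate losses -/

theorem quadSurrogate_eq {d : ℕ} {κ : ℝ} (hκ : 0 < κ) (x g y : Fin d → ℝ) :
    quadSurrogate κ x g y = 1 / (2 * κ) * (1 + κ * (g ⬝ᵥ (y - x))) ^ 2 := by
  have h1 : √(κ / 2) = κ * (1 / √(2 * κ)) := by
    rw [mul_one_div, Real.sqrt_eq_iff_mul_self_eq (by positivity) (by positivity),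
      div_mul_div_comm, Real.mul_self_sqrt (by positivity)]
    field_simp
  have h2 : (1 / √(2 * κ)) ^ 2 = 1 / (2 * κ) := by
    rw [div_pow, one_pow, Real.sq_sqrt (by positivity)]
  rw [quadSurrogate, h1, ← h2]
  ring

/-- The Taylor expansion of the surrogate about an arbitrary point. -/
theorem quadSurrogate_expand {d : ℕ} {κ : ℝ} (hκ : 0 < κ) (x g y z : Fin d → ℝ) :
    quadSurrogate κ x g z = quadSurrogate κ x g y +
      (1 + κ * (g ⬝ᵥ (y - x))) * (g ⬝ᵥ (z - y)) + κ / 2 * (g ⬝ᵥ (z - y)) ^ 2 := by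
  have h1 : g ⬝ᵥ (z - x) = g ⬝ᵥ (y - x) + g ⬝ᵥ (z - y) := by
    rw [← dotProduct_add]; congr 1; abel
  rw [quadSurrogate_eq hκ, quadSurrogate_eq hκ, h1]
  field_simp
  ring

/-- The surrogate is differentiable, so its only subgradient is its gradient. -/
theorem IsSubgradient.eq_smul_of_quadSurrogate {d : ℕ} {κ : ℝ} (hκ : 0 < κ)
    {x g y q : Fin d → ℝ} (h : IsSubgradient (quadSurrogate κ x g) y q) :
    q = (1 + κ * (g ⬝ᵥ (y - x))) • g := by
  have key : ∀ v, q ⬝ᵥ v - (1 + κ * (g ⬝ᵥ (y - x))) * (g ⬝ᵥ v) ≤ 0 := by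
    intro v
    refine nonpos_of_mul_le_sq_mul (b := κ / 2 * (g ⬝ᵥ v) ^ 2) fun ε _ _ => ?_
    have h1 := h (y + ε • v)
    rw [quadSurrogate_expand hκ x g y (y + ε • v), add_sub_cancel_left, dotProduct_smul,
      dotProduct_smul, smul_eq_mul, smul_eq_mul] at h1
    linarith
  ext k
  have h1 := key (Pi.single k 1)
  have h2 := key (Pi.single k (-1))
  simp only [dotProduct_single] at h1 h2
  simp only [Pi.smul_apply, smul_eq_mul]
  linarith

/-- Curvature of the surrogate at `y` in the direction of its own gradient there. -/
theorem quadSurrogate_curvature {d : ℕ} {κ β : ℝ} (hκ : 0 < κ)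
    {x g y q : Fin d → ℝ} (h : IsSubgradient (quadSurrogate κ x g) y q)
    (hβκ : β * (1 + κ * (g ⬝ᵥ (y - x))) ^ 2 ≤ κ) (u : Fin d → ℝ) :
    quadSurrogate κ x g y + q ⬝ᵥ (u - y) + β / 2 * (q ⬝ᵥ (u - y)) ^ 2 ≤
      quadSurrogate κ x g u := by
  rw [quadSurrogate_expand hκ x g y u, h.eq_smul_of_quadSurrogate hκ, smul_dotProduct,
    smul_eq_mul]
  nlinarith [mul_le_mul_of_nonneg_right hβκ (sq_nonneg (g ⬝ᵥ (u - y)))]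

/-- `exp (-e q²)`, as a function of `q = 1 + r`, lies below its tangent at `q = 1`. The range of
`r` exceeds the interval on which `exp (-e q²)` is concave. -/
theorem exp_neg_mul_le_tangent {e r : ℝ} (he : 0 ≤ e) (he2 : 2 * e ≤ 1)
    (hr : 0 ≤ r → e * (2 + r) ^ 2 ≤ 2) :
    Real.exp (-(e * (2 * r + r ^ 2))) ≤ 1 - 2 * e * r := by
  rcases le_total 0 r with h0 | h0
  · set y := e * (2 * r + r ^ 2) with hy
    have hy0 : 0 ≤ y := by positivity
    have h1 : Real.exp (-y) ≤ 1 - y + y ^ 2 / 2 := by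
      rw [Real.exp_neg, inv_le_iff_one_le_mul₀ (Real.exp_pos _)]
      have h2 := Real.quadratic_le_exp_of_nonneg hy0
      have h3 : 0 ≤ 1 - y + y ^ 2 / 2 := by nlinarith [sq_nonneg (y - 1)]
      calc (1 : ℝ) ≤ (1 - y + y ^ 2 / 2) * (1 + y + y ^ 2 / 2) := by nlinarith [sq_nonneg (y ^ 2)]
        _ ≤ _ := mul_le_mul_of_nonneg_left h2 h3
    have h4 : y ^ 2 / 2 ≤ e * r ^ 2 := by
      have := mul_le_mul_of_nonneg_left (hr h0) (by positivity : 0 ≤ e * r ^ 2)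
      rw [hy]
      linarith
    linarith
  · have hx : 0 ≤ -(2 * e * r) := by nlinarith
    have h1 := Real.le_log_one_add_of_nonneg hx
    have h2 : -(e * (2 * r + r ^ 2)) ≤ Real.log (1 - 2 * e * r) := by
      rw [sub_eq_add_neg]
      refine le_trans ?_ h1
      rw [le_div_iff₀ (by linarith)]
      nlinarith [mul_nonneg (mul_nonneg he (sq_nonneg r)) (by linarith : 0 ≤ 1 - 2 * e),
        mul_nonneg (mul_nonneg he hx) (sq_nonneg r)]
    rwa [← Real.le_log_iff_exp_le (by linarith)]

/-- Mixability of the surrogate at the played point: the point `x` about which the surrogate is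
built is the mean of the `y j`, which makes the linear terms of the tangent bounds cancel. -/
theorem quadSurrogate_mix {d : ℕ} {κ η : ℝ} (hκ : 0 < κ) (hη : 0 < η) (hηκ : η ≤ κ)
    (s : Finset ℕ) {v : ℕ → ℝ} (hv : ∀ j ∈ s, 0 < v j) (hsum : ∑ j ∈ s, v j = 1)
    {x g : Fin d → ℝ} {y : ℕ → Fin d → ℝ} (hx : x = ∑ j ∈ s, v j • y j)
    (hr : ∀ j ∈ s, 0 ≤ κ * (g ⬝ᵥ (y j - x)) →
      η / (2 * κ) * (2 + κ * (g ⬝ᵥ (y j - x))) ^ 2 ≤ 2) :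
    ∑ j ∈ s, v j * Real.exp (-η * quadSurrogate κ x g (y j)) ≤
      Real.exp (-η * quadSurrogate κ x g x) := by
  set e := η / (2 * κ) with he
  have hlin : ∑ j ∈ s, v j * (κ * (g ⬝ᵥ (y j - x))) = 0 := by
    have h1 : ∑ j ∈ s, v j • (y j - x) = 0 := by
      simp only [smul_sub, Finset.sum_sub_distrib, ← Finset.sum_smul, hsum, one_smul]
      rw [← hx, sub_self]
    calc ∑ j ∈ s, v j * (κ * (g ⬝ᵥ (y j - x))) = κ * (g ⬝ᵥ ∑ j ∈ s, v j • (y j - x)) := by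
          rw [dotProduct_sum, Finset.mul_sum]
          refine Finset.sum_congr rfl fun j _ => ?_
          rw [dotProduct_smul, smul_eq_mul]
          ring
      _ = 0 := by rw [h1]; simp
  have hxx : Real.exp (-η * quadSurrogate κ x g x) = Real.exp (-e) := by
    rw [quadSurrogate_eq hκ]
    congr 1
    simp [he]
    ring
  have hterm : ∀ j ∈ s, v j * Real.exp (-η * quadSurrogate κ x g (y j)) ≤
      Real.exp (-e) * (v j - 2 * e * (v j * (κ * (g ⬝ᵥ (y j - x))))) := by
    intro j hj
    have h1 := exp_neg_mul_le_tangent (by positivity)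
      (by rw [he]; field_simp; linarith : 2 * e ≤ 1) (hr j hj)
    have h2 : -η * quadSurrogate κ x g (y j) =
        -e + -(e * (2 * (κ * (g ⬝ᵥ (y j - x))) + (κ * (g ⬝ᵥ (y j - x))) ^ 2)) := by
      rw [quadSurrogate_eq hκ, he]
      field_simp
      ring
    rw [h2, Real.exp_add]
    have h3 := mul_le_mul_of_nonneg_left h1
      (mul_nonneg (hv j hj).le (Real.exp_pos (-e)).le)
    linarith
  calc _ ≤ ∑ j ∈ s, Real.exp (-e) * (v j - 2 * e * (v j * (κ * (g ⬝ᵥ (y j - x))))) :=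
        Finset.sum_le_sum hterm
    _ = Real.exp (-e) := by
        rw [← Finset.mul_sum, Finset.sum_sub_distrib, ← Finset.mul_sum, hlin, hsum]
        simp
    _ = _ := hxx.symm

/-! ### Averages over the unit interval -/

/-- `F` is integrable over `[0, 1]` and its average there is `c`. -/
structure HasMean (F : ℝ → ℝ) (c : ℝ) : Prop where
  integrable : IntervalIntegrable F MeasureTheory.volume 0 1
  integral_eq : ∫ θ in (0 : ℝ)..1, F θ = c

theorem HasMean.const (c : ℝ) : HasMean (fun _ => c) c :=
  ⟨intervalIntegrable_const, by simp⟩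

theorem HasMean.add {F F' : ℝ → ℝ} {c c' : ℝ} (h : HasMean F c) (h' : HasMean F' c') :
    HasMean (fun θ => F θ + F' θ) (c + c') :=
  ⟨h.integrable.add h'.integrable, by
    rw [intervalIntegral.integral_add h.integrable h'.integrable, h.integral_eq,
      h'.integral_eq]⟩

theorem HasMean.const_mul {F : ℝ → ℝ} {c : ℝ} (a : ℝ) (h : HasMean F c) :
    HasMean (fun θ => a * F θ) (a * c) :=
  ⟨h.integrable.const_mul a, by rw [intervalIntegral.integral_const_mul, h.integral_eq]⟩

theorem HasMean.sum {ι : Type*} (s : Finset ι) {F : ι → ℝ → ℝ} {c : ι → ℝ}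
    (h : ∀ i ∈ s, HasMean (F i) (c i)) : HasMean (fun θ => ∑ i ∈ s, F i θ) (∑ i ∈ s, c i) := by
  classical
  induction s using Finset.induction_on with
  | empty => simpa using HasMean.const 0
  | insert i s hi ih =>
    simp only [Finset.sum_insert hi]
    exact (h i (by simp)).add (ih fun j hj => h j (by simp [hj]))

theorem HasMean.le_of_le {F : ℝ → ℝ} {a c : ℝ} (h : HasMean F c)
    (hle : ∀ θ ∈ Set.Ioo (0 : ℝ) 1, a ≤ F θ) : a ≤ c := by
  rw [← h.integral_eq, ← (HasMean.const a).integral_eq]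
  exact intervalIntegral.integral_mono_on_of_le_Ioo zero_le_one intervalIntegrable_const
    h.integrable hle

theorem hasMean_ceil (x : ℝ) : HasMean (fun θ => (⌈x - θ⌉ : ℝ)) x := by
  have hanti : Antitone (fun θ : ℝ => (⌈x - θ⌉ : ℝ)) := fun a b hab => by
    simpa using Int.ceil_mono (sub_le_sub_left hab x)
  refine ⟨hanti.intervalIntegrable, ?_⟩
  have hper : Function.Periodic (Int.fract : ℝ → ℝ) 1 := fun y => Int.fract_add_one y
  have hint : IntervalIntegrable (fun θ : ℝ => Int.fract (θ - x)) MeasureTheory.volume 0 1 := by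
    have h1 : (fun θ : ℝ => Int.fract (θ - x)) = fun θ => (⌈x - θ⌉ : ℝ) - (x - θ) := by
      ext θ
      rw [Int.fract, ← neg_sub x θ, Int.floor_neg]
      push_cast
      ring
    rw [h1]
    exact hanti.intervalIntegrable.sub
      ((by fun_prop : Continuous fun θ : ℝ => x - θ).intervalIntegrable 0 1)
  have hfract : ∫ θ in (0 : ℝ)..1, Int.fract (θ - x) = 1 / 2 := by
    rw [intervalIntegral.integral_comp_sub_right (fun y : ℝ => Int.fract y)]
    have h1 := hper.intervalIntegral_add_eq (0 - x) 0
    rw [show (1 : ℝ) - x = 0 - x + 1 by ring, h1, zero_add,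
      intervalIntegral.integral_congr_Ioo_of_le (g := fun y => y) zero_le_one]
    · simp
    · intro y hy
      exact Int.fract_eq_self.2 ⟨hy.1.le, hy.2⟩
  have heq : (fun θ : ℝ => (⌈x - θ⌉ : ℝ)) = fun θ => (x - θ) + Int.fract (θ - x) := by
    ext θ
    rw [Int.fract, ← neg_sub x θ, Int.floor_neg]
    push_cast
    ring
  rw [heq, intervalIntegral.integral_add
    ((by fun_prop : Continuous fun θ : ℝ => x - θ).intervalIntegrable 0 1) hint, hfract,
    intervalIntegral.integral_sub (by simp) (by simp)]
  simp

theorem hasMean_abs_ceil_sub (x y : ℝ) :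
    HasMean (fun θ => |(⌈x - θ⌉ : ℝ) - ⌈y - θ⌉|) |x - y| := by
  wlog hxy : y ≤ x generalizing x y
  · simpa only [abs_sub_comm] using this y x (le_of_not_ge hxy)
  have h := (hasMean_ceil x).add ((hasMean_ceil y).const_mul (-1))
  convert h using 1
  · ext θ
    rw [abs_of_nonneg]
    · ring
    · simpa using Int.ceil_mono (sub_le_sub_right hxy θ)
  · rw [abs_of_nonneg (by linarith)]
    ring

/-! ### Randomized rounding of the comparators -/

/-- The randomized rounding of `x` to the grid `-R + δ ℤ`: the grid point above `x` if the relative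
position of `x` in its cell exceeds the threshold `θ`, and the one below otherwise. -/
def gridRound (R δ θ x : ℝ) : ℝ := -R + δ * ⌈(x + R) / δ - θ⌉

theorem abs_gridRound_le {R x θ : ℝ} {m : ℕ} (hm : 1 ≤ m) (hR : 0 < R) (hx : |x| ≤ R)
    (hθ : θ ∈ Set.Ioo (0 : ℝ) 1) : |gridRound R (2 * R / m) θ x| ≤ R := by
  have hm' : (0 : ℝ) < m := by exact_mod_cast hm
  obtain ⟨h1, h2⟩ := abs_le.1 hx
  have hq0 : 0 ≤ (x + R) / (2 * R / m) := by
    have : 0 ≤ x + R := by linarith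
    positivity
  have hqm : (x + R) / (2 * R / m) ≤ m := by
    rw [div_le_iff₀ (by positivity), mul_div_cancel₀ _ hm'.ne']
    linarith
  have hc0 : (0 : ℝ) ≤ (⌈(x + R) / (2 * R / m) - θ⌉ : ℝ) := by
    have : 0 ≤ ⌈(x + R) / (2 * R / m) - θ⌉ := by
      rw [Int.le_ceil_iff]
      push_cast
      linarith [hθ.2]
    exact_mod_cast this
  have hcm : (⌈(x + R) / (2 * R / m) - θ⌉ : ℝ) ≤ m := by
    have : ⌈(x + R) / (2 * R / m) - θ⌉ ≤ (m : ℤ) := by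
      rw [Int.ceil_le]
      push_cast
      linarith [hθ.1]
    exact_mod_cast this
  have hδ : 0 ≤ 2 * R / m := by positivity
  have h3 := mul_nonneg hδ hc0
  have h4 := mul_le_mul_of_nonneg_left hcm hδ
  rw [div_mul_cancel₀ _ hm'.ne'] at h4
  rw [gridRound, abs_le]
  constructor <;> linarith

theorem gridRound_sub {R δ : ℝ} (hδ : 0 < δ) (θ x : ℝ) :
    gridRound R δ θ x - x = δ * (⌈(x + R) / δ - θ⌉ + -((x + R) / δ)) := by
  rw [gridRound]
  field_simp
  ring

theorem abs_gridRound_sub_le {R δ θ : ℝ} (hδ : 0 < δ) (hθ : θ ∈ Set.Ioo (0 : ℝ) 1) (x : ℝ) :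
    |gridRound R δ θ x - x| ≤ δ := by
  have h1 := Int.le_ceil ((x + R) / δ - θ)
  have h2 := Int.ceil_lt_add_one ((x + R) / δ - θ)
  rw [gridRound_sub hδ, abs_mul, abs_of_pos hδ]
  refine mul_le_of_le_one_right hδ.le (abs_le.2 ⟨?_, ?_⟩) <;> linarith [hθ.1, hθ.2]

theorem hasMean_gridRound_sub {R δ : ℝ} (hδ : 0 < δ) (x : ℝ) :
    HasMean (fun θ => gridRound R δ θ x - x) 0 := by
  have h := ((hasMean_ceil ((x + R) / δ)).add (HasMean.const (-((x + R) / δ)))).const_mul δ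
  rw [add_neg_cancel, mul_zero] at h
  simpa only [gridRound_sub hδ] using h

open Classical in
/-- The number of rounds `t ∈ [2, n]` with `v t ≠ v (t - 1)`. -/
def numChanges {V : Type*} (n : ℕ) (v : ℕ → V) : ℝ :=
  ∑ t ∈ Finset.Icc 2 n, if v t = v (t - 1) then 0 else 1

theorem numChanges_le {V : Type*} {n : ℕ} (hn : 1 ≤ n) (v : ℕ → V) :
    1 + numChanges n v ≤ n := by
  classical
  have h : numChanges n v ≤ ∑ t ∈ Finset.Icc 2 n, (1 : ℝ) :=
    Finset.sum_le_sum fun t _ => by split_ifs <;> norm_num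
  have h2 : ((n + 1 - 2 : ℕ) : ℝ) = n - 1 := by
    rw [show n + 1 - 2 = n - 1 by omega, Nat.cast_sub hn, Nat.cast_one]
  simp only [Finset.sum_const, Nat.card_Icc, nsmul_eq_mul, mul_one, h2] at h
  linarith

/-- A regret bound on all intervals against constant comparators gives a regret bound against
piecewise constant comparators, with one such term for each piece. -/
theorem sum_le_of_interval_le {V : Type*} {n : ℕ} (hn : 1 ≤ n) {K : Set V} {Γ : ℝ}
    {a : ℕ → V → ℝ}
    (hΓ : ∀ r s, 1 ≤ r → r ≤ s → s ≤ n → ∀ x ∈ K, ∑ t ∈ Finset.Icc r s, a t x ≤ Γ)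
    {v : ℕ → V} (hv : ∀ t, 1 ≤ t → t ≤ n → v t ∈ K) :
    ∑ t ∈ Finset.Icc 1 n, a t (v t) ≤ Γ * (1 + numChanges n v) := by
  classical
  have hpiece : ∀ r T, 1 ≤ r → r ≤ T → T ≤ n → (∀ t, r ≤ t → t ≤ T → v t = v T) →
      ∑ t ∈ Finset.Icc r T, a t (v t) ≤ Γ := by
    intro r T hr hrT hTn hconst
    have hcongr : ∑ t ∈ Finset.Icc r T, a t (v t) = ∑ t ∈ Finset.Icc r T, a t (v T) :=
      Finset.sum_congr rfl fun t ht => by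
        rw [Finset.mem_Icc] at ht
        rw [hconst t ht.1 ht.2]
    rw [hcongr]
    exact hΓ r T hr hrT hTn _ (hv T (by omega) hTn)
  have key : ∀ T, 1 ≤ T → T ≤ n → ∃ r, 1 ≤ r ∧ r ≤ T ∧ (∀ t, r ≤ t → t ≤ T → v t = v T) ∧
      ∑ t ∈ Finset.Ico 1 r, a t (v t) ≤ Γ * numChanges T v := by
    intro T hT
    induction T, hT using Nat.le_induction with
    | base =>
      intro _
      exact ⟨1, le_rfl, le_rfl, fun t h1 h2 => by rw [le_antisymm h2 h1], by simp [numChanges]⟩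
    | succ T hT ih =>
      intro hTn
      obtain ⟨r, hr1, hrT, hconst, hle⟩ := ih (by omega)
      have hsucc : numChanges (T + 1) v =
          numChanges T v + if v (T + 1) = v T then 0 else 1 := by
        rw [numChanges, Finset.sum_Icc_succ_top (by omega), numChanges, Nat.add_sub_cancel]
      by_cases heq : v (T + 1) = v T
      · refine ⟨r, hr1, by omega, fun t h1 h2 => ?_, by simpa [hsucc, heq] using hle⟩
        rcases eq_or_ne t (T + 1) with rfl | hne
        · rfl
        · rw [heq, hconst t h1 (by omega)]
      · refine ⟨T + 1, by omega, le_rfl, fun t h1 h2 => by rw [le_antisymm h2 h1], ?_⟩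
        rw [← Finset.sum_Ico_consecutive _ hr1 (by omega : r ≤ T + 1), hsucc, if_neg heq, mul_add,
          mul_one, Finset.Ico_add_one_right_eq_Icc]
        exact add_le_add hle (hpiece r T hr1 hrT (by omega) hconst)
  obtain ⟨r, hr1, hrn, hconst, hle⟩ := key n hn le_rfl
  rw [← Finset.Ico_add_one_right_eq_Icc, ← Finset.sum_Ico_consecutive _ hr1
    (by omega : r ≤ n + 1), mul_add, mul_one, add_comm, Finset.Ico_add_one_right_eq_Icc]
  exact add_le_add (hpiece r n hr1 hrn le_rfl hconst) hle

theorem numChanges_gridRound_le {d n : ℕ} (R δ θ : ℝ) (u : ℕ → Fin d → ℝ) :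
    numChanges n (fun t k => gridRound R δ θ (u t k)) ≤
      ∑ t ∈ Finset.Icc 2 n, ∑ k, |(⌈(u t k + R) / δ - θ⌉ : ℝ) - ⌈(u (t - 1) k + R) / δ - θ⌉| := by
  classical
  refine Finset.sum_le_sum fun t _ => ?_
  split_ifs with h
  · positivity
  · have hne : ∃ k, ⌈(u t k + R) / δ - θ⌉ ≠ ⌈(u (t - 1) k + R) / δ - θ⌉ := by
      by_contra! hall
      exact h (by ext k; simp only [gridRound, hall k])
    obtain ⟨k, hk⟩ := hne
    refine le_trans ?_ (Finset.single_le_sum (fun j _ => abs_nonneg _) (Finset.mem_univ k))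
    have := Int.one_le_abs (sub_ne_zero.2 hk)
    exact_mod_cast this

/-- Interval regret bounds and the randomized rounding to a grid of width `2R/m`. The rounding is
unbiased, so only the second-order term of `hquad` survives averaging over the threshold, and a
coordinate that moves by `x` is expected to cross `m x / (2R)` grid cells. -/
theorem sum_le_of_interval_le_of_grid {d n m : ℕ} (hn : 1 ≤ n) (hm : 1 ≤ m) {R Γ c : ℝ}
    (hR : 0 < R) (hΓ0 : 0 ≤ Γ) {a : ℕ → (Fin d → ℝ) → ℝ} {p u : ℕ → Fin d → ℝ}
    (hΓ : ∀ r s, 1 ≤ r → r ≤ s → s ≤ n → ∀ x ∈ box d R, ∑ t ∈ Finset.Icc r s, a t x ≤ Γ)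
    (hu : ∀ t, 1 ≤ t → t ≤ n → u t ∈ box d R)
    (hquad : ∀ t, 1 ≤ t → t ≤ n → ∀ x δ, (∀ k, |x k - u t k| ≤ δ) →
      a t (u t) ≤ a t x + p t ⬝ᵥ (x - u t) + c * δ ^ 2) :
    ∑ t ∈ Finset.Icc 1 n, a t (u t) ≤
      Γ * (1 + m / (2 * R) * pathVariation n u) + n * (c * (2 * R / m) ^ 2) := by
  have hm' : (0 : ℝ) < m := by exact_mod_cast hm
  set δ := 2 * R / m with hδdef
  have hδ : 0 < δ := by positivity
  have hmean1 : HasMean (fun θ => ∑ t ∈ Finset.Icc 2 n, ∑ k,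
      |(⌈(u t k + R) / δ - θ⌉ : ℝ) - ⌈(u (t - 1) k + R) / δ - θ⌉|)
      (m / (2 * R) * pathVariation n u) := by
    have hsum := HasMean.sum (Finset.Icc 2 n) fun t _ =>
      HasMean.sum (Finset.univ : Finset (Fin d)) fun k _ =>
        hasMean_abs_ceil_sub ((u t k + R) / δ) ((u (t - 1) k + R) / δ)
    convert hsum using 1
    rw [pathVariation, Finset.mul_sum]
    refine Finset.sum_congr rfl fun t _ => ?_
    rw [l1Norm, Finset.mul_sum]
    refine Finset.sum_congr rfl fun k _ => ?_
    rw [← sub_div, abs_div, abs_of_pos hδ, hδdef, Pi.sub_apply]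
    rw [show u t k + R - (u (t - 1) k + R) = u t k - u (t - 1) k by ring]
    field_simp
  have hmean2 : HasMean (fun θ => ∑ t ∈ Finset.Icc 1 n, ∑ k,
      p t k * (gridRound R δ θ (u t k) - u t k)) 0 := by
    have hsum := HasMean.sum (Finset.Icc 1 n) fun t _ =>
      HasMean.sum (Finset.univ : Finset (Fin d)) fun k _ =>
        (hasMean_gridRound_sub (R := R) hδ (u t k)).const_mul (p t k)
    simpa using hsum
  have hmean := (((HasMean.const 1).add hmean1).const_mul Γ).add
    (hmean2.add (HasMean.const (n * (c * δ ^ 2))))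
  rw [zero_add] at hmean
  refine hmean.le_of_le fun θ hθ => ?_
  have h1 : ∑ t ∈ Finset.Icc 1 n, a t (fun k => gridRound R δ θ (u t k)) ≤
      Γ * (1 + numChanges n (fun t k => gridRound R δ θ (u t k))) :=
    sum_le_of_interval_le hn hΓ (v := fun t k => gridRound R δ θ (u t k))
      fun t h1 h2 k => abs_gridRound_le hm hR (hu t h1 h2 k) hθ
  have h2 := mul_le_mul_of_nonneg_left
    (add_le_add_right (numChanges_gridRound_le (n := n) R δ θ u) 1) hΓ0
  have h3 : ∑ t ∈ Finset.Icc 1 n, a t (u t) ≤ ∑ t ∈ Finset.Icc 1 n,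
      (a t (fun k => gridRound R δ θ (u t k)) +
        ∑ k, p t k * (gridRound R δ θ (u t k) - u t k) + c * δ ^ 2) := by
    refine Finset.sum_le_sum fun t ht => ?_
    rw [Finset.mem_Icc] at ht
    exact hquad t ht.1 ht.2 _ δ fun k => abs_gridRound_sub_le hδ hθ (u t k)
  rw [Finset.sum_add_distrib, Finset.sum_add_distrib, Finset.sum_const, Nat.card_Icc,
    Nat.add_sub_cancel, nsmul_eq_mul] at h3
  linarith

theorem pathVariation_nonneg {d : ℕ} (n : ℕ) (u : ℕ → Fin d → ℝ) : 0 ≤ pathVariation n u :=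
  Finset.sum_nonneg fun _ _ => Finset.sum_nonneg fun _ _ => abs_nonneg _

/-- The bound of `sum_le_of_interval_le_of_grid` for the grid size that balances its two terms. If
the claimed rate exceeds `n`, then the trivial count of `n` pieces replaces the rounding. -/
theorem sum_le_of_interval_le_of_pathVariation {d n : ℕ} (hn : 1 ≤ n) {R Γ c : ℝ}
    (hR : 0 < R) (hΓ0 : 0 ≤ Γ) (hc : 0 ≤ c) {a : ℕ → (Fin d → ℝ) → ℝ} {p u : ℕ → Fin d → ℝ}
    (hΓ : ∀ r s, 1 ≤ r → r ≤ s → s ≤ n → ∀ x ∈ box d R, ∑ t ∈ Finset.Icc r s, a t x ≤ Γ)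
    (hu : ∀ t, 1 ≤ t → t ≤ n → u t ∈ box d R)
    (hquad : ∀ t, 1 ≤ t → t ≤ n → ∀ x δ, (∀ k, |x k - u t k| ≤ δ) →
      a t (u t) ≤ a t x + p t ⬝ᵥ (x - u t) + c * δ ^ 2) :
    ∑ t ∈ Finset.Icc 1 n, a t (u t) ≤ (Γ * (1 + 1 / R) + 4 * c * R ^ 2) *
      max ((n : ℝ) ^ (1 / 3 : ℝ) * pathVariation n u ^ (2 / 3 : ℝ)) 1 := by
  set P := pathVariation n u with hP
  have hP0 : 0 ≤ P := pathVariation_nonneg n u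
  set B := max ((n : ℝ) ^ (1 / 3 : ℝ) * P ^ (2 / 3 : ℝ)) 1 with hB
  have hB1 : 1 ≤ B := le_max_right _ _
  have hB0 : 0 < B := one_pos.trans_le hB1
  have hn0 : (0 : ℝ) < n := by exact_mod_cast hn
  rcases le_or_gt (n : ℝ) B with hnB | hnB
  · calc ∑ t ∈ Finset.Icc 1 n, a t (u t) ≤ Γ * (1 + numChanges n u) :=
          sum_le_of_interval_le hn hΓ hu
      _ ≤ Γ * B := mul_le_mul_of_nonneg_left ((numChanges_le hn u).trans hnB) hΓ0
      _ ≤ _ := by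
          refine mul_le_mul_of_nonneg_right ?_ hB0.le
          have : 0 ≤ Γ * (1 / R) + 4 * c * R ^ 2 := by positivity
          linarith
  · set q := √(n / B) with hq
    have hq1 : 1 ≤ q := by
      rw [hq, Real.one_le_sqrt, one_le_div hB0]
      exact hnB.le
    have hqq : q ^ 2 = n / B := Real.sq_sqrt (by positivity)
    set m := ⌈q⌉₊ with hm
    have hqm : q ≤ m := Nat.le_ceil q
    have hm1 : 1 ≤ m := by exact_mod_cast hq1.trans hqm
    have hm0 : (0 : ℝ) < m := by exact_mod_cast hm1
    have hmq : (m : ℝ) ≤ 2 * q := by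
      have := Nat.ceil_lt_add_one (by linarith : 0 ≤ q)
      linarith
    have hPq : P * q ≤ B := by
      have h1 : (n : ℝ) * P ^ 2 ≤ B ^ 3 := by
        have h2 : ((n : ℝ) ^ (1 / 3 : ℝ) * P ^ (2 / 3 : ℝ)) ^ 3 = n * P ^ 2 := by
          rw [mul_pow, ← Real.rpow_natCast, ← Real.rpow_natCast, ← Real.rpow_mul hn0.le,
            ← Real.rpow_mul hP0]
          norm_num
        rw [← h2]
        exact pow_le_pow_left₀ (by positivity) (le_max_left _ _) 3
      refine le_of_sq_le_sq ?_ hB0.le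
      rw [mul_pow, hqq, mul_div_assoc', div_le_iff₀ hB0]
      linarith
    have h1 := sum_le_of_interval_le_of_grid hn hm1 hR hΓ0 hΓ hu hquad
    have h2 : m / (2 * R) * P ≤ 1 / R * B := by
      rw [div_mul_eq_mul_div, div_le_iff₀ (by positivity)]
      have : 1 / R * B * (2 * R) = 2 * B := by field_simp
      rw [this]
      nlinarith
    have h3 : n * (c * (2 * R / m) ^ 2) ≤ 4 * c * R ^ 2 * B := by
      have h4 : (n : ℝ) ≤ m ^ 2 * B := by
        have := pow_le_pow_left₀ (by linarith) hqm 2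
        rwa [hqq, div_le_iff₀ hB0] at this
      rw [div_pow, mul_div_assoc', mul_div_assoc', div_le_iff₀ (by positivity)]
      have := mul_le_mul_of_nonneg_left h4 (by positivity : 0 ≤ 4 * c * R ^ 2)
      linarith
    have h5 := mul_le_mul_of_nonneg_left (add_le_add hB1 h2) hΓ0
    linarith

/-! ### The barrier and the barrier loss -/

section Barrier

variable {p d : ℕ} {A : Matrix (Fin p) (Fin d) ℝ} {b : Fin p → ℝ} {D : Set (Fin d → ℝ)} {G : ℝ}

theorem rowGap_nonneg (A : Matrix (Fin p) (Fin d) ℝ) (x w : Fin d → ℝ) : 0 ≤ rowGap A x w :=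
  Real.iSup_nonneg fun _ => abs_nonneg _

theorem abs_le_rowGap (A : Matrix (Fin p) (Fin d) ℝ) (x w : Fin d → ℝ) (i : Fin p) :
    |(A *ᵥ (x - w)) i| ≤ rowGap A x w :=
  le_ciSup (f := fun i => |(A *ᵥ (x - w)) i|) (Set.finite_range _).bddAbove i

theorem barrier_le (A : Matrix (Fin p) (Fin d) ℝ) {x : Fin d → ℝ} (hx : x ∈ D) (w : Fin d → ℝ) :
    barrier A D w ≤ rowGap A x w :=
  csInf_le ⟨0, by rintro _ ⟨y, -, rfl⟩; exact rowGap_nonneg A y w⟩ ⟨x, hx, rfl⟩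

theorem le_barrier (hD : D.Nonempty) {w : Fin d → ℝ} {c : ℝ} (h : ∀ x ∈ D, c ≤ rowGap A x w) :
    c ≤ barrier A D w :=
  le_csInf (hD.image _) (by rintro _ ⟨y, hy, rfl⟩; exact h y hy)

theorem barrier_eq_zero_of_mem (A : Matrix (Fin p) (Fin d) ℝ) {u : Fin d → ℝ} (hu : u ∈ D) :
    barrier A D u = 0 := by
  refine le_antisymm ((barrier_le A hu u).trans ?_)
    (le_barrier ⟨u, hu⟩ fun x _ => rowGap_nonneg A x u)
  simp [rowGap]

theorem barrier_add_le (hD : D.Nonempty) {c : ℝ} (hc : 0 ≤ c) {v : Fin d → ℝ}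
    (hv : ∀ i, |(A *ᵥ v) i| ≤ c) (w : Fin d → ℝ) :
    barrier A D (w + v) ≤ barrier A D w + c := by
  have h : barrier A D (w + v) - c ≤ barrier A D w := by
    refine le_barrier hD fun x hx => ?_
    have h1 : rowGap A x (w + v) ≤ rowGap A x w + c := by
      refine Real.iSup_le (fun i => ?_) (add_nonneg (rowGap_nonneg A x w) hc)
      have h2 : (A *ᵥ (x - (w + v))) i = (A *ᵥ (x - w)) i - (A *ᵥ v) i := by
        rw [← Pi.sub_apply, ← Matrix.mulVec_sub, sub_sub]
      rw [h2]
      exact (abs_sub _ _).trans (add_le_add (abs_le_rowGap A x w i) (hv i))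
    linarith [barrier_le A hx (w + v)]
  linarith

theorem barrier_convex (hconv : Convex ℝ D) (hD : D.Nonempty) {ε : ℝ} (h0 : 0 ≤ ε) (h1 : ε ≤ 1)
    (w v : Fin d → ℝ) :
    barrier A D (w + ε • v) ≤ (1 - ε) * barrier A D w + ε * barrier A D (w + v) := by
  refine le_of_forall_pos_le_add fun δ hδ => ?_
  obtain ⟨_, ⟨x, hx, rfl⟩, hx'⟩ := exists_lt_of_csInf_lt (hD.image _)
    (lt_add_of_pos_right (barrier A D w) hδ)
  obtain ⟨_, ⟨y, hy, rfl⟩, hy'⟩ := exists_lt_of_csInf_lt (hD.image _)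
    (lt_add_of_pos_right (barrier A D (w + v)) hδ)
  have h3 : rowGap A ((1 - ε) • x + ε • y) (w + ε • v) ≤
      (1 - ε) * rowGap A x w + ε * rowGap A y (w + v) := by
    refine Real.iSup_le (fun i => ?_) (add_nonneg
      (mul_nonneg (by linarith) (rowGap_nonneg A x w)) (mul_nonneg h0 (rowGap_nonneg A y _)))
    have h4 : (1 - ε) • x + ε • y - (w + ε • v) = (1 - ε) • (x - w) + ε • (y - (w + v)) := by
      module
    rw [h4, Matrix.mulVec_add, Matrix.mulVec_smul, Matrix.mulVec_smul, Pi.add_apply,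
      Pi.smul_apply, Pi.smul_apply, smul_eq_mul, smul_eq_mul]
    refine (abs_add_le _ _).trans (add_le_add ?_ ?_)
    · rw [abs_mul, abs_of_nonneg (by linarith : 0 ≤ 1 - ε)]
      exact mul_le_mul_of_nonneg_left (abs_le_rowGap A x w i) (by linarith)
    · rw [abs_mul, abs_of_nonneg h0]
      exact mul_le_mul_of_nonneg_left (abs_le_rowGap A y (w + v) i) h0
  have h5 := barrier_le A (hconv hx hy (by linarith : 0 ≤ 1 - ε) h0 (by ring)) (w + ε • v)
  have h6 := mul_le_mul_of_nonneg_left hx'.le (by linarith : 0 ≤ 1 - ε)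
  have h7 := mul_le_mul_of_nonneg_left hy'.le h0
  linarith

theorem regLoss_add (A : Matrix (Fin p) (Fin d) ℝ) (b : Fin p → ℝ) (w v : Fin d → ℝ) :
    regLoss A b (w + v) = regLoss A b w +
      ∑ i, (2 * ((A *ᵥ w) i - b i)) * (A *ᵥ v) i + ∑ i, (A *ᵥ v) i ^ 2 := by
  rw [regLoss, regLoss, ← Finset.sum_add_distrib, ← Finset.sum_add_distrib]
  refine Finset.sum_congr rfl fun i _ => ?_
  rw [Matrix.mulVec_add, Pi.add_apply]
  ring

theorem regLoss_add_smul (A : Matrix (Fin p) (Fin d) ℝ) (b : Fin p → ℝ) (w v : Fin d → ℝ)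
    (ε : ℝ) : regLoss A b (w + ε • v) = regLoss A b w +
      ε * ∑ i, (2 * ((A *ᵥ w) i - b i)) * (A *ᵥ v) i + ε ^ 2 * ∑ i, (A *ᵥ v) i ^ 2 := by
  rw [regLoss_add, Finset.mul_sum, Finset.mul_sum]
  congr 1
  · congr 1
    refine Finset.sum_congr rfl fun i _ => ?_
    rw [Matrix.mulVec_smul, Pi.smul_apply, smul_eq_mul]
    ring
  · refine Finset.sum_congr rfl fun i _ => ?_
    rw [Matrix.mulVec_smul, Pi.smul_apply, smul_eq_mul]
    ring

/-- A subgradient of the barrier loss is bounded in every direction by the directional derivative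
of the regression loss and the Lipschitz bound of the barrier. -/
theorem IsSubgradient.dotProduct_le (hG : 0 ≤ G) (hD : D.Nonempty) {w g : Fin d → ℝ}
    (h : IsSubgradient (barrierLoss A b D G) w g) {c : ℝ} (hc : 0 ≤ c) {v : Fin d → ℝ}
    (hv : ∀ i, |(A *ᵥ v) i| ≤ c) :
    g ⬝ᵥ v ≤ ∑ i, (2 * ((A *ᵥ w) i - b i)) * (A *ᵥ v) i + G * c := by
  rw [← sub_nonpos]
  refine nonpos_of_mul_le_sq_mul (b := ∑ i, (A *ᵥ v) i ^ 2) fun ε h0 _ => ?_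
  have h1 := h (w + ε • v)
  have h2 : barrier A D (w + ε • v) ≤ barrier A D w + ε * c := by
    refine barrier_add_le hD (by positivity) (fun i => ?_) w
    rw [Matrix.mulVec_smul, Pi.smul_apply, smul_eq_mul, abs_mul, abs_of_pos h0]
    exact mul_le_mul_of_nonneg_left (hv i) h0.le
  have h3 := mul_le_mul_of_nonneg_left h2 hG
  rw [barrierLoss, barrierLoss, regLoss_add_smul, add_sub_cancel_left, dotProduct_smul,
    smul_eq_mul] at h1
  linarith

/-- The barrier loss is strongly convex in the seminorm `‖A v‖₂`, because the barrier is convex. -/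
theorem IsSubgradient.add_sum_sq_le (hG : 0 ≤ G) (hconv : Convex ℝ D) (hD : D.Nonempty)
    {w g : Fin d → ℝ} (h : IsSubgradient (barrierLoss A b D G) w g) (v : Fin d → ℝ) :
    barrierLoss A b D G w + g ⬝ᵥ v + ∑ i, (A *ᵥ v) i ^ 2 ≤ barrierLoss A b D G (w + v) := by
  have key : g ⬝ᵥ v - ∑ i, (2 * ((A *ᵥ w) i - b i)) * (A *ᵥ v) i -
      G * (barrier A D (w + v) - barrier A D w) ≤ 0 := by
    refine nonpos_of_mul_le_sq_mul (b := ∑ i, (A *ᵥ v) i ^ 2) fun ε h0 h1 => ?_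
    have h2 := h (w + ε • v)
    have h3 := mul_le_mul_of_nonneg_left (barrier_convex (A := A) hconv hD h0.le h1 w v) hG
    rw [barrierLoss, barrierLoss, regLoss_add_smul, add_sub_cancel_left, dotProduct_smul,
      smul_eq_mul] at h2
    linarith
  rw [barrierLoss, barrierLoss, regLoss_add]
  linarith

theorem IsSubgradient.abs_dotProduct_le (hD : D.Nonempty) {w g : Fin d → ℝ}
    (h : IsSubgradient (barrierLoss A b D G) w g)
    (hr : ∑ i, |2 * ((A *ᵥ w) i - b i)| ≤ G) {c : ℝ} (hc : 0 ≤ c) {v : Fin d → ℝ}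
    (hv : ∀ i, |(A *ᵥ v) i| ≤ c) : |g ⬝ᵥ v| ≤ 2 * G * c := by
  have hG : 0 ≤ G := le_trans (Finset.sum_nonneg fun _ _ => abs_nonneg _) hr
  have key : ∀ v : Fin d → ℝ, (∀ i, |(A *ᵥ v) i| ≤ c) → g ⬝ᵥ v ≤ 2 * G * c := by
    intro v hv
    have h1 := h.dotProduct_le hG hD hc hv
    have h2 : ∑ i, (2 * ((A *ᵥ w) i - b i)) * (A *ᵥ v) i ≤
        ∑ i, |2 * ((A *ᵥ w) i - b i)| * c := by
      refine Finset.sum_le_sum fun i _ => (le_abs_self _).trans ?_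
      rw [abs_mul]
      exact mul_le_mul_of_nonneg_left (hv i) (abs_nonneg _)
    rw [← Finset.sum_mul] at h2
    have h3 := mul_le_mul_of_nonneg_right hr hc
    linarith
  refine abs_le.2 ⟨?_, key v hv⟩
  have := key (-v) fun i => by rw [Matrix.mulVec_neg, Pi.neg_apply, abs_neg]; exact hv i
  rw [dotProduct_neg] at this
  linarith

/-- The derivative of the barrier loss in direction `v` is controlled by `‖A v‖₂`; this is what
turns strong convexity in that seminorm into exp-concavity. -/
theorem IsSubgradient.sq_dotProduct_le (hG : 0 ≤ G) (hD : D.Nonempty) {w g : Fin d → ℝ}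
    (h : IsSubgradient (barrierLoss A b D G) w g) {L : ℝ}
    (hL : 2 * regLoss A b w + 2 * G ^ 2 ≤ L) (v : Fin d → ℝ) :
    (g ⬝ᵥ v) ^ 2 ≤ 4 * L * ∑ i, (A *ᵥ v) i ^ 2 := by
  set N := √(∑ i, (A *ᵥ v) i ^ 2) with hN
  have hN0 : 0 ≤ N := Real.sqrt_nonneg _
  have hNN : N ^ 2 = ∑ i, (A *ᵥ v) i ^ 2 := Real.sq_sqrt (Finset.sum_nonneg fun _ _ => sq_nonneg _)
  set ρ := √(regLoss A b w) with hρ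
  have hf0 : 0 ≤ regLoss A b w := Finset.sum_nonneg fun _ _ => sq_nonneg _
  have hρρ : ρ ^ 2 = regLoss A b w := Real.sq_sqrt hf0
  have hρ0 : 0 ≤ ρ := Real.sqrt_nonneg _
  have hvN : ∀ i, |(A *ᵥ v) i| ≤ N := fun i => Real.abs_le_sqrt
    (Finset.single_le_sum (f := fun i => (A *ᵥ v) i ^ 2) (fun _ _ => sq_nonneg _)
      (Finset.mem_univ i))
  have hcs : |∑ i, (2 * ((A *ᵥ w) i - b i)) * (A *ᵥ v) i| ≤ 2 * ρ * N := by
    refine abs_le_of_sq_le_sq ?_ (by positivity)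
    refine (Finset.sum_mul_sq_le_sq_mul_sq _ _ _).trans (le_of_eq ?_)
    have h4 : ∑ i, (2 * ((A *ᵥ w) i - b i)) ^ 2 = 2 ^ 2 * regLoss A b w := by
      rw [regLoss, Finset.mul_sum]
      exact Finset.sum_congr rfl fun i _ => by ring
    rw [mul_pow, hNN, mul_pow, hρρ, h4]
  obtain ⟨hcs1, hcs2⟩ := abs_le.1 hcs
  have h1 := h.dotProduct_le hG hD hN0 hvN
  have h2 := h.dotProduct_le hG hD hN0 (v := -v) fun i => by
    rw [Matrix.mulVec_neg, Pi.neg_apply, abs_neg]; exact hvN i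
  simp only [Matrix.mulVec_neg, Pi.neg_apply, mul_neg, Finset.sum_neg_distrib,
    dotProduct_neg] at h2
  have h3 : |g ⬝ᵥ v| ≤ (2 * ρ + G) * N := abs_le.2 ⟨by linarith, by linarith⟩
  have h4 := sq_le_sq' (by linarith [(abs_le.1 h3).1]) (abs_le.1 h3).2
  rw [← hNN]
  refine h4.trans ?_
  rw [mul_pow]
  refine mul_le_mul_of_nonneg_right ?_ (sq_nonneg N)
  nlinarith [sq_nonneg (2 * ρ - G)]

theorem abs_mulVec_le {α : ℝ} (hA : ∀ i, l1Norm (A i) ≤ α) {δ : ℝ} (hδ : 0 ≤ δ)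
    {v : Fin d → ℝ} (hv : ∀ k, |v k| ≤ δ) (i : Fin p) : |(A *ᵥ v) i| ≤ α * δ := by
  calc |(A *ᵥ v) i| ≤ ∑ k, |A i k * v k| :=
        Finset.abs_sum_le_sum_abs (fun k => A i k * v k) Finset.univ
    _ ≤ ∑ k, |A i k| * δ := Finset.sum_le_sum fun k _ => by
        rw [abs_mul]
        exact mul_le_mul_of_nonneg_left (hv k) (abs_nonneg _)
    _ = l1Norm (A i) * δ := by rw [l1Norm, Finset.sum_mul]
    _ ≤ α * δ := mul_le_mul_of_nonneg_right (hA i) hδ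

theorem sum_abs_residual_le {w : Fin d → ℝ} (h : l1Norm (A *ᵥ (w + w) - (2 : ℝ) • b) ≤ G) :
    ∑ i, |2 * ((A *ᵥ w) i - b i)| ≤ G := by
  refine le_trans (le_of_eq (Finset.sum_congr rfl fun i _ => ?_)) h
  congr 1
  simp [Matrix.mulVec_add]
  ring

theorem abs_mulVec_sub_le {w y : Fin d → ℝ} (hw : l1Norm (A *ᵥ (w + w) - (2 : ℝ) • b) ≤ G)
    (hy : l1Norm (A *ᵥ (y + y) - (2 : ℝ) • b) ≤ G) (i : Fin p) :
    |(A *ᵥ (y - w)) i| ≤ G := by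
  have h1 := (Finset.single_le_sum (f := fun i => |2 * ((A *ᵥ w) i - b i)|)
    (fun _ _ => abs_nonneg _) (Finset.mem_univ i)).trans (sum_abs_residual_le hw)
  have h2 := (Finset.single_le_sum (f := fun i => |2 * ((A *ᵥ y) i - b i)|)
    (fun _ _ => abs_nonneg _) (Finset.mem_univ i)).trans (sum_abs_residual_le hy)
  simp only [Matrix.mulVec_sub, Pi.sub_apply]
  rw [abs_le] at *
  constructor <;> linarith [h1.1, h1.2, h2.1, h2.2]

/-- The barrier pays for replacing the improper play `w` by its closest point `z` of `D`. -/
theorem regLoss_le_barrierLoss {w z : Fin d → ℝ} (hG : 0 ≤ G)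
    (hz : IsArgmin (fun x => rowGap A x w) D z)
    (h : l1Norm (A *ᵥ (z + w) - (2 : ℝ) • b) ≤ G) : regLoss A b z ≤ barrierLoss A b D G w := by
  have h1 : rowGap A z w ≤ barrier A D w := le_barrier ⟨z, hz.1⟩ hz.2
  have h2 : regLoss A b z - regLoss A b w =
      ∑ i, (A *ᵥ (z + w) - (2 : ℝ) • b) i * (A *ᵥ (z - w)) i := by
    rw [regLoss, regLoss, ← Finset.sum_sub_distrib]
    refine Finset.sum_congr rfl fun i _ => ?_
    simp only [Matrix.mulVec_add, Matrix.mulVec_sub, Pi.sub_apply, Pi.add_apply, Pi.smul_apply,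
      smul_eq_mul]
    ring
  have h3 : ∑ i, (A *ᵥ (z + w) - (2 : ℝ) • b) i * (A *ᵥ (z - w)) i ≤
      l1Norm (A *ᵥ (z + w) - (2 : ℝ) • b) * rowGap A z w := by
    rw [l1Norm, Finset.sum_mul]
    refine Finset.sum_le_sum fun i _ => (le_abs_self _).trans ?_
    rw [abs_mul]
    exact mul_le_mul_of_nonneg_left (abs_le_rowGap A z w i) (abs_nonneg _)
  have h4 := mul_le_mul h h1 (rowGap_nonneg A z w) hG
  rw [barrierLoss]
  linarith

theorem barrierLoss_of_mem {u : Fin d → ℝ} (hu : u ∈ D) :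
    barrierLoss A b D G u = regLoss A b u := by
  rw [barrierLoss, barrier_eq_zero_of_mem A hu, mul_zero, add_zero]

end Barrier

/-! ### Admissible values of `G` and `L` -/

theorem convex_box (d : ℕ) (R : ℝ) : Convex ℝ (box d R) := by
  intro x hx y hy a c ha hc hac k
  simp only [Pi.add_apply, Pi.smul_apply, smul_eq_mul]
  calc |a * x k + c * y k| ≤ |a * x k| + |c * y k| := abs_add_le _ _
    _ = a * |x k| + c * |y k| := by rw [abs_mul, abs_mul, abs_of_nonneg ha, abs_of_nonneg hc]
    _ ≤ a * R + c * R := add_le_add (mul_le_mul_of_nonneg_left (hx k) ha)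
        (mul_le_mul_of_nonneg_left (hy k) hc)
    _ = R := by rw [← add_mul, hac, one_mul]

theorem l1Norm_residual_le {p d : ℕ} {A : Matrix (Fin p) (Fin d) ℝ} {b : Fin p → ℝ} {α R σ : ℝ}
    (hR : 0 ≤ R) (hA : ∀ i, l1Norm (A i) ≤ α) (hb : l1Norm b ≤ σ)
    {w : Fin d → ℝ} (hw : w ∈ box d R) : ∑ i, |(A *ᵥ w) i - b i| ≤ p * α * R + σ := by
  calc ∑ i, |(A *ᵥ w) i - b i| ≤ ∑ i, (α * R + |b i|) := Finset.sum_le_sum fun i _ =>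
        (abs_sub _ _).trans (add_le_add (abs_mulVec_le hA hR hw i) le_rfl)
    _ = p * α * R + l1Norm b := by
        rw [Finset.sum_add_distrib, l1Norm]
        simp
        ring
    _ ≤ _ := by linarith

theorem validG_and_validL_of_bounded {p d n : ℕ} {α R σ : ℝ} (hR : 0 < R)
    {A : ℕ → Matrix (Fin p) (Fin d) ℝ} {b : ℕ → Fin p → ℝ} (hA : RowsBounded α n A)
    (hb : ∀ t, 1 ≤ t → t ≤ n → l1Norm (b t) ≤ σ) :
    ValidG R (2 * p * α * R + 2 * σ) n A b ∧
      ValidL R (2 * p * α * R + 2 * σ) (10 * (p * α * R + σ) ^ 2) n A b := by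
  have hres : ∀ t, 1 ≤ t → t ≤ n → ∀ w ∈ box d R,
      ∑ i, |(A t *ᵥ w) i - b t i| ≤ p * α * R + σ := fun t h1 h2 w hw =>
    l1Norm_residual_le hR.le (hA t h1 h2) (hb t h1 h2) hw
  constructor
  · intro t h1 h2 w₁ hw₁ w₂ hw₂
    have h3 := hres t h1 h2 w₁ hw₁
    have h4 := hres t h1 h2 w₂ hw₂
    have h5 : l1Norm (A t *ᵥ (w₁ + w₂) - (2 : ℝ) • b t) ≤
        ∑ i, |(A t *ᵥ w₁) i - b t i| + ∑ i, |(A t *ᵥ w₂) i - b t i| := by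
      rw [← Finset.sum_add_distrib]
      refine Finset.sum_le_sum fun i _ => le_trans (le_of_eq ?_) (abs_add_le _ _)
      congr 1
      simp [Matrix.mulVec_add]
      ring
    linarith
  · intro t h1 h2 w hw
    have h3 := hres t h1 h2 w hw
    have h0 : 0 ≤ ∑ i, |(A t *ᵥ w) i - b t i| := Finset.sum_nonneg fun _ _ => abs_nonneg _
    have h4 : regLoss (A t) (b t) w ≤ (∑ i, |(A t *ᵥ w) i - b t i|) ^ 2 := by
      have := Finset.sum_sq_le_sq_sum_of_nonneg (s := Finset.univ)
        (f := fun i => |(A t *ᵥ w) i - b t i|) (fun _ _ => abs_nonneg _)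
      simpa [regLoss, sq_abs] using this
    have h5 := pow_le_pow_left₀ h0 h3 2
    linarith

/-! ### Interval regret of FLH-ONS -/

/-- The properties of `γ` that the choice of `η` and `ζ` relies on. The last one is the mixability
condition of `quadSurrogate_mix` for `η = 1/(2γ²)`. The value of the affine form inside the
surrogate is `√(2L) + s/√(8L)`, with `s ≤ 4GαR`; for `d < 4` it may exceed `γ`, but its distance
from `√(2L)` is at most twice that of `γ`, which suffices. -/
theorem gammaParam_bounds {d : ℕ} (hd : 1 ≤ d) {α R G L : ℝ} (hα : 0 < α) (hR : 0 < R)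
    (hG : 0 < G) (hL : 0 < L) :
    0 < gammaParam d α R G L ∧ 2 * L ≤ gammaParam d α R G L ^ 2 ∧
      gammaParam d α R G L ^ 2 ≤ d * gammaParam 1 α R G L ^ 2 ∧
      ∀ s, 0 ≤ s → s ≤ 4 * G * α * R →
        L * (2 + 1 / (4 * L) * s) ^ 2 ≤ 2 * gammaParam d α R G L ^ 2 := by
  have hd' : (1 : ℝ) ≤ d := by exact_mod_cast hd
  set a := √(2 * L) with ha
  have ha0 : 0 < a := Real.sqrt_pos.2 (by positivity)
  have haa : a ^ 2 = 2 * L := Real.sq_sqrt (by positivity)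
  set q := √((d : ℝ) / (8 * L)) with hq
  have hq0 : 0 ≤ q := Real.sqrt_nonneg _
  have hqq : q ^ 2 = d / (8 * L) := Real.sq_sqrt (by positivity)
  have hγ : gammaParam d α R G L = 2 * G * α * R * q + a := rfl
  have hm : 0 < G * α * R := by positivity
  have haγ : a ≤ gammaParam d α R G L := by
    have : 0 ≤ 2 * G * α * R * q := by positivity
    rw [hγ]; linarith
  refine ⟨ha0.trans_le haγ, haa ▸ pow_le_pow_left₀ ha0.le haγ 2, ?_, ?_⟩
  · have h1 : gammaParam d α R G L ≤ √d * gammaParam 1 α R G L := by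
      have h2 : q = √d * √((1 : ℕ) / (8 * L)) := by
        rw [← Real.sqrt_mul (by positivity), hq]
        congr 1
        push_cast
        ring
      have h3 : a ≤ √d * a := le_mul_of_one_le_left ha0.le (Real.one_le_sqrt.2 hd')
      rw [hγ, gammaParam, ← ha, h2]
      linarith
    have h4 := pow_le_pow_left₀ (ha0.trans_le haγ).le h1 2
    rwa [mul_pow, Real.sq_sqrt (by positivity)] at h4
  · intro s hs0 hs
    -- `q ≥ 1 / (2 a)` is where `d ≥ 1` enters.
    have haq : 1 / 2 ≤ a * q := by
      refine le_of_sq_le_sq ?_ (by positivity)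
      rw [mul_pow, haa, hqq]
      have : 2 * L * (d / (8 * L)) = d / 4 := by field_simp; norm_num
      rw [this]
      linarith
    have h1 : a + s / (4 * a) ≤ gammaParam d α R G L := by
      have h2 : s / (4 * a) ≤ 2 * G * α * R * q := by
        rw [div_le_iff₀ (by positivity)]
        nlinarith [mul_le_mul_of_nonneg_left haq hm.le]
      rw [hγ]; linarith
    have h3 := pow_le_pow_left₀ (by positivity) h1 2
    have h4 : L * (2 + 1 / (4 * L) * s) ^ 2 = 2 * (a + s / (4 * a)) ^ 2 := by
      have hL' : L = a ^ 2 / 2 := by linarith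
      rw [hL']
      field_simp
    linarith

/-- A bound on the inverse of `ζ` that is linear in the dimension. -/
def zetaInvBound (α R G L : ℝ) : ℝ := 16 * G * α * R + 4 * gammaParam 1 α R G L ^ 2

theorem zetaParam_bounds {d : ℕ} (hd : 1 ≤ d) {α R G L : ℝ} (hα : 0 < α) (hR : 0 < R)
    (hG : 0 < G) (hL : 0 < L) :
    0 < zetaParam d α R G L ∧ zetaParam d α R G L ≤ 1 / (8 * L) ∧
      1 / zetaParam d α R G L ≤ d * zetaInvBound α R G L := by
  obtain ⟨h1, h2, h3, -⟩ := gammaParam_bounds hd hα hR hG hL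
  have hd' : (1 : ℝ) ≤ d := by exact_mod_cast hd
  have hd0 : (0 : ℝ) < d := by linarith
  have hZ : 0 < zetaInvBound α R G L := by rw [zetaInvBound]; positivity
  have hsd : √(d : ℝ) ≤ d := Real.sqrt_le_iff.2 ⟨hd0.le, by nlinarith⟩
  have hsd0 : 0 < √(d : ℝ) := Real.sqrt_pos.2 hd0
  have hm : 0 < G * α * R := by positivity
  have hlow : 1 / (d * zetaInvBound α R G L) ≤ zetaParam d α R G L := by
    refine le_min ?_ ?_
    · refine one_div_le_one_div_of_le (by positivity) ?_
      rw [zetaInvBound]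
      nlinarith [mul_le_mul_of_nonneg_left hsd hm.le,
        mul_nonneg hd0.le (sq_nonneg (gammaParam 1 α R G L))]
    · refine one_div_le_one_div_of_le (by positivity) ?_
      rw [zetaInvBound]
      nlinarith [mul_pos hd0 hm]
  have hpos : 0 < zetaParam d α R G L := lt_of_lt_of_le (by positivity) hlow
  refine ⟨hpos, (min_le_right _ _).trans
    (one_div_le_one_div_of_le (by positivity) (by linarith)), ?_⟩
  rw [one_div_le hpos (by positivity)]
  exact hlow

/-- The factor of `d³ (1 + log n)` in the interval regret of FLH-ONS. -/
def intervalConst (α R G L : ℝ) : ℝ :=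
  2 * gammaParam 1 α R G L ^ 2 +
    zetaInvBound α R G L / 2 * (2 + (5 / 2 * G * α) ^ 2 * zetaInvBound α R G L) +
    R ^ 2 / (128 * L ^ 2)

theorem IsONS.mem_box {d n s : ℕ} {R β ε : ℝ} (hR : 0 ≤ R) {h : ℕ → (Fin d → ℝ) → ℝ}
    {y g : ℕ → Fin d → ℝ} (H : IsONS (box d R) β ε n s h y g) {t : ℕ} (hst : s ≤ t)
    (htn : t ≤ n) : y t ∈ box d R := by
  rcases eq_or_lt_of_le hst with rfl | hlt
  · rw [H.init]
    intro k
    simpa using hR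
  · obtain ⟨q, rfl⟩ : ∃ q, t = q + 1 := ⟨t - 1, by omega⟩
    exact (H.step q (by omega) (by omega)).1

theorem IsFLH.play_mem {d n : ℕ} {η : ℝ} {h : ℕ → (Fin d → ℝ) → ℝ} {E : ℕ → ℕ → Fin d → ℝ}
    {v : ℕ → ℕ → ℝ} {x : ℕ → Fin d → ℝ} (H : IsFLH η n h E v x) {K : Set (Fin d → ℝ)}
    (hK : Convex ℝ K) {t : ℕ} (h1 : 1 ≤ t) (htn : t ≤ n)
    (hE : ∀ j, 1 ≤ j → j ≤ t → E j t ∈ K) : x t ∈ K := by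
  obtain ⟨hpos, hsum⟩ := H.weight_pos_and_sum h1 htn
  rw [H.play t h1 htn]
  refine hK.sum_mem (fun j hj => (hpos j hj).le) hsum fun j hj => ?_
  rw [Finset.mem_Icc] at hj
  exact hE j hj.1 hj.2

/-- The regret of FLH-ONS on an interval `[r, s]`, with respect to the surrogate losses: FLH
competes with the base learner started in round `r`, which competes with the fixed point `u`. -/
theorem flhons_interval_regret_le {d n : ℕ} (hd : 1 ≤ d) {α R G L : ℝ} (hα : 0 < α)
    (hR : 0 < R) (hG : 0 < G) (hL : 0 < L) {x g : ℕ → Fin d → ℝ} {E gE : ℕ → ℕ → Fin d → ℝ}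
    {v : ℕ → ℕ → ℝ}
    (hONS : ∀ j, 1 ≤ j → j ≤ n → IsONS (box d R) (zetaParam d α R G L) (zetaParam d α R G L) n j
      (fun t => quadSurrogate (1 / (4 * L)) (x t) (g t)) (E j) (gE j))
    (hFLH : IsFLH (1 / (2 * gammaParam d α R G L ^ 2)) n
      (fun t => quadSurrogate (1 / (4 * L)) (x t) (g t)) E v x)
    (hg1 : ∀ t, 1 ≤ t → t ≤ n → ∀ k, |g t k| ≤ 2 * G * α)
    (hg2 : ∀ t, 1 ≤ t → t ≤ n → ∀ y ∈ box d R, |g t ⬝ᵥ (y - x t)| ≤ 4 * G * α * R)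
    (hg3 : ∀ t, 1 ≤ t → t ≤ n → ∀ y ∈ box d R, |g t ⬝ᵥ (y - x t)| ≤ L)
    {r s : ℕ} (hr : 1 ≤ r) (hrs : r ≤ s) (hsn : s ≤ n) {u : Fin d → ℝ} (hu : u ∈ box d R) :
    ∑ t ∈ Finset.Icc r s, (quadSurrogate (1 / (4 * L)) (x t) (g t) (x t) -
        quadSurrogate (1 / (4 * L)) (x t) (g t) u) ≤
      intervalConst α R G L * (d ^ 3 * (1 + Real.log n)) := by
  obtain ⟨hγ0, hγ1, hγ2, hγ3⟩ := gammaParam_bounds hd hα hR hG hL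
  obtain ⟨hζ0, hζ1, hζ2⟩ := zetaParam_bounds hd hα hR hG hL
  have hd' : (1 : ℝ) ≤ d := by exact_mod_cast hd
  have hn' : (1 : ℝ) ≤ n := by exact_mod_cast (by omega : 1 ≤ n)
  have hlogn : 0 ≤ Real.log n := Real.log_nonneg hn'
  have hκ : 0 < 1 / (4 * L) := by positivity
  have hE : ∀ j t, 1 ≤ j → j ≤ t → t ≤ n → E j t ∈ box d R := fun j t h1 h2 h3 =>
    (hONS j h1 (by omega)).mem_box hR.le h2 h3
  set γ := gammaParam d α R G L with hγ
  set ζ := zetaParam d α R G L with hζ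
  set Z := zetaInvBound α R G L with hZ
  have hZ0 : 0 < Z := by rw [hZ, zetaInvBound]; positivity
  set c₀ := (5 / 2 * G * α) ^ 2 with hc₀
  have hc₀0 : 0 ≤ c₀ := sq_nonneg _
  -- FLH against the base learner started in round `r`.
  have hflh := hFLH.regret_le (by positivity) (fun t h1 h2 => by
    obtain ⟨hpos, hsum⟩ := hFLH.weight_pos_and_sum h1 h2
    refine quadSurrogate_mix hκ (by positivity) ?_ (Finset.Icc 1 t) hpos hsum
      (y := fun j => E j t) (hFLH.play t h1 h2) fun j hj hs => ?_
    · exact one_div_le_one_div_of_le (by positivity) (by linarith)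
    · rw [Finset.mem_Icc] at hj
      have h3 := hγ3 (g t ⬝ᵥ (E j t - x t)) (by
          by_contra! hneg
          exact absurd hs (not_le.2 (mul_neg_of_pos_of_neg hκ hneg)))
        ((le_abs_self _).trans (hg2 t h1 h2 _ (hE j t hj.1 hj.2 h2)))
      have h4 : 1 / (2 * γ ^ 2) / (2 * (1 / (4 * L))) = L / γ ^ 2 := by
        field_simp
        norm_num
      rw [h4, div_mul_eq_mul_div, div_le_iff₀ (by positivity)]
      exact h3) hr hrs hsn
  -- The base learner against `u`.
  have hrange : ∀ t, r ≤ t → t ≤ n → (1 + 1 / (4 * L) * (g t ⬝ᵥ (E r t - x t))) ^ 2 ≤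
      (5 / 4) ^ 2 := by
    intro t h1 h2
    have h3 := abs_le.1 (hg3 t (by omega) h2 _ (hE r t hr h1 h2))
    have h4 : 1 / (4 * L) * (g t ⬝ᵥ (E r t - x t)) ≤ 1 / 4 := by
      rw [one_div_mul_eq_div, div_le_iff₀ (by positivity)]
      linarith [h3.2]
    have h5 : -(1 / 4) ≤ 1 / (4 * L) * (g t ⬝ᵥ (E r t - x t)) := by
      rw [one_div_mul_eq_div, le_div_iff₀ (by positivity)]
      linarith [h3.1]
    exact pow_le_pow_left₀ (by linarith) (by linarith) 2
  have hons := (hONS r hr (by omega)).regret_le_sum (convex_box d R) hζ0 hζ0 hu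
    (fun t h1 h2 => by
      refine quadSurrogate_curvature hκ ((hONS r hr (by omega)).grad t h1 h2) ?_ u
      calc ζ * (1 + 1 / (4 * L) * (g t ⬝ᵥ (E r t - x t))) ^ 2 ≤
            1 / (8 * L) * (5 / 4) ^ 2 := mul_le_mul hζ1 (hrange t h1 h2) (sq_nonneg _)
              (by positivity)
        _ ≤ 1 / (4 * L) := by
            rw [div_mul_eq_mul_div, div_le_div_iff₀ (by positivity) (by positivity)]
            linarith) hrs hsn
  have hgE : ∀ t ∈ Finset.Ico r (s + 1), gE r t ⬝ᵥ gE r t ≤ d * c₀ := by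
    intro t ht
    rw [Finset.mem_Ico] at ht
    rw [((hONS r hr (by omega)).grad t ht.1 (by omega)).eq_smul_of_quadSurrogate hκ,
      smul_dotProduct, dotProduct_smul, smul_eq_mul, smul_eq_mul, ← mul_assoc, ← sq]
    have h1 : g t ⬝ᵥ g t ≤ d * (2 * G * α) ^ 2 := by
      calc g t ⬝ᵥ g t ≤ ∑ _k : Fin d, (2 * G * α) ^ 2 := by
            refine Finset.sum_le_sum fun k _ => ?_
            rw [← sq, ← sq_abs]
            exact pow_le_pow_left₀ (abs_nonneg _) (hg1 t (by omega) (by omega) k) 2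
        _ = _ := by simp
    calc _ ≤ (5 / 4) ^ 2 * (d * (2 * G * α) ^ 2) :=
          mul_le_mul (hrange t ht.1 (by omega)) h1
            (Finset.sum_nonneg fun _ _ => mul_self_nonneg _) (by positivity)
      _ = _ := by rw [hc₀]; ring
  have hgsum : ∑ t ∈ Finset.Ico r (s + 1), gE r t ⬝ᵥ gE r t ≤ n * (d * c₀) := by
    refine (Finset.sum_le_card_nsmul _ _ _ hgE).trans ?_
    rw [Nat.card_Ico, nsmul_eq_mul]
    refine mul_le_mul_of_nonneg_right ?_ (by positivity)
    exact_mod_cast (by omega : s + 1 - r ≤ n)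
  have hgsum0 : 0 ≤ ∑ t ∈ Finset.Ico r (s + 1), gE r t ⬝ᵥ gE r t :=
    Finset.sum_nonneg fun _ _ => Finset.sum_nonneg fun _ _ => mul_self_nonneg _
  have hell := sum_quadForm_inv_le hd hζ0 (gE r) (by omega : r ≤ s + 1)
  have hlog : Real.log (d + (∑ t ∈ Finset.Ico r (s + 1), gE r t ⬝ᵥ gE r t) / ζ) ≤
      d * ((2 + c₀ * Z) * (1 + Real.log n)) := by
    have h1 : (d : ℝ) + (∑ t ∈ Finset.Ico r (s + 1), gE r t ⬝ᵥ gE r t) / ζ ≤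
        n * (d * (d * (1 + c₀ * Z))) := by
      have h2 : (∑ t ∈ Finset.Ico r (s + 1), gE r t ⬝ᵥ gE r t) / ζ ≤
          n * (d * c₀) * (d * Z) := by
        rw [← mul_one_div]
        exact mul_le_mul hgsum hζ2 (by positivity) (by positivity)
      have h3 : (d : ℝ) ≤ n * (d * d) := by nlinarith [mul_le_mul hn' hd' zero_le_one (by linarith)]
      linarith
    have h4 : Real.log (n * (d * (d * (1 + c₀ * Z)))) =
        Real.log n + (Real.log d + (Real.log d + Real.log (1 + c₀ * Z))) := by
      have : 0 < 1 + c₀ * Z := by positivity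
      rw [Real.log_mul (by positivity) (by positivity), Real.log_mul (by positivity)
        (by positivity), Real.log_mul (by positivity) this.ne']
    have h5 := Real.log_le_log (by positivity) h1
    have h6 := Real.log_le_sub_one_of_pos (by positivity : 0 < (d : ℝ))
    have h7 := Real.log_le_sub_one_of_pos (by positivity : 0 < 1 + c₀ * Z)
    have h8 : 0 ≤ c₀ * Z := by positivity
    have h9 : 2 * (d : ℝ) + c₀ * Z + Real.log n ≤
        d * ((2 + c₀ * Z) * (1 + Real.log n)) := by
      have e1 : 0 ≤ c₀ * Z * Real.log n := by positivity
      have e2 := mul_le_mul_of_nonneg_right hd' (by positivity :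
        0 ≤ c₀ * Z + 2 * Real.log n + c₀ * Z * Real.log n)
      linarith
    linarith
  have huu : u ⬝ᵥ u ≤ d * R ^ 2 := by
    calc u ⬝ᵥ u ≤ ∑ _k : Fin d, R ^ 2 := by
          refine Finset.sum_le_sum fun k _ => ?_
          rw [← sq, ← sq_abs]
          exact pow_le_pow_left₀ (abs_nonneg _) (hu k) 2
      _ = _ := by simp
  have hd3 : (d : ℝ) ≤ d ^ 3 := le_self_pow₀ hd' (by norm_num)
  -- The three contributions to the regret.
  have hA : Real.log s / (1 / (2 * γ ^ 2)) ≤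
      2 * gammaParam 1 α R G L ^ 2 * (d ^ 3 * (1 + Real.log n)) := by
    have h1 : Real.log s ≤ 1 + Real.log n := by
      have : Real.log s ≤ Real.log n := Real.log_le_log (by exact_mod_cast (by omega : 0 < s))
        (by exact_mod_cast hsn)
      linarith
    rw [div_div_eq_mul_div, div_one]
    calc _ ≤ (1 + Real.log n) * (2 * (d * gammaParam 1 α R G L ^ 2)) :=
          mul_le_mul h1 (by linarith) (by positivity) (by positivity)
      _ ≤ (1 + Real.log n) * (2 * (d ^ 3 * gammaParam 1 α R G L ^ 2)) := by gcongr
      _ = _ := by ring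
  have hB : 1 / (2 * ζ) * ∑ t ∈ Finset.Ico r (s + 1),
      gE r t ⬝ᵥ ((gramMatrix ζ (gE r) r (t + 1))⁻¹ *ᵥ gE r t) ≤
      Z / 2 * (2 + c₀ * Z) * (d ^ 3 * (1 + Real.log n)) := by
    calc _ ≤ 1 / (2 * ζ) * (d * (d * ((2 + c₀ * Z) * (1 + Real.log n)))) := by
          refine mul_le_mul_of_nonneg_left (hell.trans ?_) (by positivity)
          exact mul_le_mul_of_nonneg_left hlog (by positivity)
      _ = 1 / ζ * (d * (d * ((2 + c₀ * Z) * (1 + Real.log n))) / 2) := by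
          field_simp
      _ ≤ d * Z * (d * (d * ((2 + c₀ * Z) * (1 + Real.log n))) / 2) :=
          mul_le_mul_of_nonneg_right hζ2 (by positivity)
      _ = _ := by ring
  have hC : ζ * ζ / 2 * (u ⬝ᵥ u) ≤ R ^ 2 / (128 * L ^ 2) * (d ^ 3 * (1 + Real.log n)) := by
    have h1 : (d : ℝ) ≤ d ^ 3 * (1 + Real.log n) :=
      hd3.trans (le_mul_of_one_le_right (by positivity) (by linarith))
    have h0 : 0 ≤ u ⬝ᵥ u := Finset.sum_nonneg fun _ _ => mul_self_nonneg _
    calc _ ≤ 1 / (8 * L) * (1 / (8 * L)) / 2 * (d * R ^ 2) := by gcongr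
      _ = R ^ 2 / (128 * L ^ 2) * d := by field_simp; norm_num
      _ ≤ _ := mul_le_mul_of_nonneg_left h1 (by positivity)
  have hsplit : ∑ t ∈ Finset.Icc r s, (quadSurrogate (1 / (4 * L)) (x t) (g t) (x t) -
        quadSurrogate (1 / (4 * L)) (x t) (g t) u) =
      ∑ t ∈ Finset.Ico r (s + 1), (quadSurrogate (1 / (4 * L)) (x t) (g t) (x t) -
        quadSurrogate (1 / (4 * L)) (x t) (g t) (E r t)) +
      ∑ t ∈ Finset.Ico r (s + 1), (quadSurrogate (1 / (4 * L)) (x t) (g t) (E r t) -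
        quadSurrogate (1 / (4 * L)) (x t) (g t) u) := by
    rw [← Finset.sum_add_distrib, Finset.Ico_add_one_right_eq_Icc]
    exact Finset.sum_congr rfl fun t _ => by ring
  rw [hsplit, intervalConst, ← hZ, ← hc₀, add_mul, add_mul]
  linarith

/-! ### Dynamic regret of ProDR.control -/

/-- The factor of `d³ (1 + log n) (n^{1/3} TV^{2/3} ∨ 1)` in the dynamic regret. -/
def regretConst (α R G L : ℝ) : ℝ :=
  intervalConst α R G L * (1 + 1 / R) + 4 * (G ^ 2 * α ^ 2 / (2 * L)) * R ^ 2

theorem intervalConst_pos {α R G L : ℝ} (hα : 0 < α) (hR : 0 < R) (hG : 0 < G) (hL : 0 < L) :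
    0 < intervalConst α R G L := by
  have : 0 < zetaInvBound α R G L := by rw [zetaInvBound]; positivity
  rw [intervalConst]
  positivity

theorem regretConst_pos {α R G L : ℝ} (hα : 0 < α) (hR : 0 < R) (hG : 0 < G) (hL : 0 < L) :
    0 < regretConst α R G L := by
  have := intervalConst_pos hα hR hG hL
  rw [regretConst]
  positivity

theorem IsProDR.dynamicRegret_le {p d n : ℕ} (hd : 1 ≤ d) (hn : 1 ≤ n) {D : Set (Fin d → ℝ)}
    {α R G L : ℝ} (hα : 0 < α) (hR : 0 < R) (hG : 0 < G) (hL : 0 < L)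
    {A : ℕ → Matrix (Fin p) (Fin d) ℝ} {b : ℕ → Fin p → ℝ} {w z u : ℕ → Fin d → ℝ}
    (hconv : Convex ℝ D) (hDbox : D ⊆ box d R) (hrows : RowsBounded α n A)
    (hvG : ValidG R G n A b) (hvL : ValidL R G L n A b) (H : IsProDR D α R G L n A b w z)
    (hu : ∀ t, 1 ≤ t → t ≤ n → u t ∈ D) :
    dynamicRegret n A b z u ≤ regretConst α R G L * (1 + Real.log n) *
      (d ^ 3 * max ((n : ℝ) ^ (1 / 3 : ℝ) * pathVariation n u ^ (2 / 3 : ℝ)) 1) := by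
  obtain ⟨⟨g, E, gE, v, hsub, hONS, hFLH⟩, hz⟩ := H
  have hD : D.Nonempty := ⟨u 1, hu 1 le_rfl hn⟩
  have hκ : 0 < 1 / (4 * L) := by positivity
  have hw : ∀ t, 1 ≤ t → t ≤ n → w t ∈ box d R := fun t h1 h2 =>
    hFLH.play_mem (convex_box d R) h1 h2 fun j h3 h4 =>
      (hONS j h3 (by omega)).mem_box hR.le h4 h2
  have hdot : ∀ t, 1 ≤ t → t ≤ n → ∀ c, 0 ≤ c → ∀ v, (∀ i, |(A t *ᵥ v) i| ≤ c) →
      |g t ⬝ᵥ v| ≤ 2 * G * c := fun t h1 h2 c hc v hv =>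
    (hsub t h1 h2).abs_dotProduct_le hD
      (sum_abs_residual_le (hvG t h1 h2 _ (hw t h1 h2) _ (hw t h1 h2))) hc hv
  have hdotα : ∀ t, 1 ≤ t → t ≤ n → ∀ δ, 0 ≤ δ → ∀ v : Fin d → ℝ, (∀ k, |v k| ≤ δ) →
      |g t ⬝ᵥ v| ≤ 2 * G * (α * δ) := fun t h1 h2 δ hδ v hv =>
    hdot t h1 h2 _ (by positivity) v (abs_mulVec_le (hrows t h1 h2) hδ hv)
  have hG2 : 2 * G ^ 2 ≤ L := by
    have h1 := hvL 1 le_rfl hn _ (hw 1 le_rfl hn)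
    have h2 : 0 ≤ regLoss (A 1) (b 1) (w 1) := Finset.sum_nonneg fun _ _ => sq_nonneg _
    linarith
  -- The dynamic regret is bounded by that of FLH-ONS with respect to the surrogates.
  have hred : ∀ t ∈ Finset.Icc 1 n, regLoss (A t) (b t) (z t) - regLoss (A t) (b t) (u t) ≤
      quadSurrogate (1 / (4 * L)) (w t) (g t) (w t) -
        quadSurrogate (1 / (4 * L)) (w t) (g t) (u t) := by
    intro t ht
    rw [Finset.mem_Icc] at ht
    obtain ⟨h1, h2⟩ := ht
    have h3 := regLoss_le_barrierLoss hG.le (hz t h1 h2)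
      (hvG t h1 h2 _ (hDbox (hz t h1 h2).1) _ (hw t h1 h2))
    have h4 := (hsub t h1 h2).add_sum_sq_le hG.le hconv hD (u t - w t)
    rw [add_sub_cancel, barrierLoss_of_mem (hu t h1 h2)] at h4
    have h5 := (hsub t h1 h2).sq_dotProduct_le hG.le hD (hvL t h1 h2 _ (hw t h1 h2)) (u t - w t)
    have h6 := quadSurrogate_expand hκ (w t) (g t) (w t) (u t)
    rw [sub_self, dotProduct_zero, mul_zero, add_zero, one_mul] at h6
    have h7 : 1 / (4 * L) / 2 * (g t ⬝ᵥ (u t - w t)) ^ 2 ≤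
        ∑ i, (A t *ᵥ (u t - w t)) i ^ 2 := by
      have h8 : 0 ≤ ∑ i, (A t *ᵥ (u t - w t)) i ^ 2 := Finset.sum_nonneg fun _ _ => sq_nonneg _
      calc _ ≤ 1 / (4 * L) / 2 * (4 * L * ∑ i, (A t *ᵥ (u t - w t)) i ^ 2) :=
            mul_le_mul_of_nonneg_left h5 (by positivity)
        _ = (∑ i, (A t *ᵥ (u t - w t)) i ^ 2) / 2 := by field_simp
        _ ≤ _ := by linarith
    linarith
  set Γ := intervalConst α R G L * (d ^ 3 * (1 + Real.log n)) with hΓ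
  have hlogn : 0 ≤ Real.log n := Real.log_nonneg (by exact_mod_cast hn)
  have hd' : (1 : ℝ) ≤ d := by exact_mod_cast hd
  have hI := intervalConst_pos hα hR hG hL
  have hmain := sum_le_of_interval_le_of_pathVariation hn hR (Γ := Γ)
    (c := G ^ 2 * α ^ 2 / (2 * L)) (u := u)
    (a := fun t y => quadSurrogate (1 / (4 * L)) (w t) (g t) (w t) -
      quadSurrogate (1 / (4 * L)) (w t) (g t) y)
    (p := fun t => (1 + 1 / (4 * L) * (g t ⬝ᵥ (u t - w t))) • g t)
    (by positivity) (by positivity)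
    (fun r s h1 h2 h3 y hy => flhons_interval_regret_le hd hα hR hG hL hONS hFLH
      (fun t h1 h2 k => by
        have h4 := hdotα t h1 h2 1 zero_le_one (Pi.single k 1) fun j => by
          rcases eq_or_ne j k with rfl | hne
          · simp
          · simp [Pi.single_eq_of_ne hne]
        simpa [mul_assoc] using h4)
      (fun t h1 h2 y hy => by
        have h4 := hdotα t h1 h2 (2 * R) (by positivity) (y - w t) fun k =>
          (abs_sub _ _).trans (by linarith [hy k, hw t h1 h2 k])
        linarith)
      (fun t h1 h2 y hy => by
        have h4 := hdot t h1 h2 G hG.le (y - w t) (abs_mulVec_sub_le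
          (hvG t h1 h2 _ (hw t h1 h2) _ (hw t h1 h2)) (hvG t h1 h2 _ hy _ hy))
        linarith)
      h1 h2 h3 hy)
    (fun t h1 h2 => hDbox (hu t h1 h2))
    (fun t h1 h2 y δ hδ => by
      have hδ0 : 0 ≤ δ := (abs_nonneg _).trans (hδ ⟨0, hd⟩)
      have h4 := hdotα t h1 h2 δ hδ0 (y - u t) hδ
      have h5 := quadSurrogate_expand hκ (w t) (g t) (u t) y
      have h6 : (g t ⬝ᵥ (y - u t)) ^ 2 ≤ (2 * G * (α * δ)) ^ 2 := by
        rw [← sq_abs]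
        exact pow_le_pow_left₀ (abs_nonneg _) h4 2
      have h7 : 1 / (4 * L) / 2 * (g t ⬝ᵥ (y - u t)) ^ 2 ≤
          G ^ 2 * α ^ 2 / (2 * L) * δ ^ 2 := by
        calc _ ≤ 1 / (4 * L) / 2 * (2 * G * (α * δ)) ^ 2 :=
              mul_le_mul_of_nonneg_left h6 (by positivity)
          _ = _ := by field_simp; norm_num
      simp only [smul_dotProduct, smul_eq_mul]
      linarith)
  have hfac : Γ * (1 + 1 / R) + 4 * (G ^ 2 * α ^ 2 / (2 * L)) * R ^ 2 ≤
      regretConst α R G L * (1 + Real.log n) * d ^ 3 := by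
    have h1 : (1 : ℝ) ≤ d ^ 3 * (1 + Real.log n) :=
      one_le_mul_of_one_le_of_one_le (one_le_pow₀ hd') (by linarith)
    have h2 := le_mul_of_one_le_right
      (by positivity : 0 ≤ 4 * (G ^ 2 * α ^ 2 / (2 * L)) * R ^ 2) h1
    rw [regretConst, hΓ]
    linarith
  calc dynamicRegret n A b z u ≤ _ := Finset.sum_le_sum hred
    _ ≤ _ := hmain
    _ ≤ _ := mul_le_mul_of_nonneg_right hfac (by positivity)
    _ = _ := by ring

end ProDR

end

theorem theorem1 :
    (∀ (p d n : ℕ) (α R σ : ℝ), 0 < α → 0 < R →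
      ∀ (A : ℕ → Matrix (Fin p) (Fin d) ℝ) (b : ℕ → Fin p → ℝ),
        ProDR.RowsBounded α n A →
        (∀ t, 1 ≤ t → t ≤ n → ProDR.l1Norm (b t) ≤ σ) →
        ProDR.ValidG R (2 * p * α * R + 2 * σ) n A b ∧
        ProDR.ValidL R (2 * p * α * R + 2 * σ) (10 * (p * α * R + σ) ^ 2) n A b) ∧
    (∃ K : ℕ, ∀ α R G L : ℝ, 0 < α → 0 < R → 0 < G → ∃ C : ℝ, 0 < C ∧
      ∀ (p d n : ℕ) (D : Set (Fin d → ℝ))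
        (A : ℕ → Matrix (Fin p) (Fin d) ℝ) (b : ℕ → Fin p → ℝ) (w z u : ℕ → Fin d → ℝ),
        Convex ℝ D → D ⊆ ProDR.box d R →
        ProDR.RowsBounded α n A →
        ProDR.ValidG R G n A b →
        ProDR.ValidL R G L n A b →
        ProDR.IsProDR D α R G L n A b w z →
        (∀ t, 1 ≤ t → t ≤ n → u t ∈ D) →
        ProDR.dynamicRegret n A b z u ≤
          C * (1 + Real.log n) ^ K *
            ((d : ℝ) ^ 3 *
              max ((n : ℝ) ^ (1 / 3 : ℝ) * ProDR.pathVariation n u ^ (2 / 3 : ℝ)) 1)) := by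
  refine ⟨fun p d n α R σ _ hR A b hA hb => ProDR.validG_and_validL_of_bounded hR hA hb,
    1, fun α R G L hα hR hG => ?_⟩
  -- `L ≤ 0` leaves only `n = 0`, where any constant serves.
  refine ⟨if 0 < L then ProDR.regretConst α R G L else 1, ?_, ?_⟩
  · split_ifs with hL
    · exact ProDR.regretConst_pos hα hR hG hL
    · exact one_pos
  intro p d n D A b w z u hconv hDbox hrows hvG hvL H hu
  have hlogn : 0 ≤ Real.log n := Real.log_natCast_nonneg n
  rcases Nat.eq_zero_or_pos n with rfl | hn
  · have h0 : ProDR.dynamicRegret 0 A b z u = 0 := by simp [ProDR.dynamicRegret]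
    rw [h0]
    have hC : 0 ≤ if 0 < L then ProDR.regretConst α R G L else 1 := by
      split_ifs with hL
      · exact (ProDR.regretConst_pos hα hR hG hL).le
      · exact zero_le_one
    positivity
  have hL : 0 < L := by
    have h1 := hvL 1 le_rfl hn 0 fun k => by simpa using hR.le
    have h2 : 0 ≤ ProDR.regLoss (A 1) (b 1) 0 := Finset.sum_nonneg fun _ _ => sq_nonneg _
    have h3 : 0 < G ^ 2 := by positivity
    linarith
  rw [if_pos hL, pow_one]
  rcases Nat.eq_zero_or_pos d with rfl | hd
  · have h0 : ProDR.dynamicRegret n A b z u = 0 := by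
      refine Finset.sum_eq_zero fun t _ => ?_
      rw [Subsingleton.elim (z t) (u t), sub_self]
    rw [h0]
    simp
  · exact H.dynamicRegret_le hd hn hα hR hG hL hconv hDbox hrows hvG hvL hu
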